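/- Let $A$ be a (not necessarily unital) $C^*$-algebra and let $\alpha$ be a flow of $A$, i.e. a one-parameter group $(\alpha_t)_{t\in\mathbb R}$ of $*$-automorphisms of $A$ such that $t\mapsto\alpha_t(x)$ is norm continuous for every $x\in A$. Let $\delta_\alpha$ be its generator: $D(\delta_\alpha)$ is the set of $x\in A$ for which $t\mapsto\alpha_t(x)$ is differentiable at $0$, and $\delta_\alpha(x)=\frac{d}{dt}\alpha_t(x)|_{t=0}$. Condition F0: for any $\epsilon>0$ there exists $\nu>0$ such that, whenever $h=h^*\in D(\delta_\alpha)$ satisfies $\|h\|\le 1$ and $\|\delta_\alpha(h)\|<\nu$, there exist $k=k^*\in D(\delta_\alpha)$ and $b=b^*\in A$ with $\|h-k\|<\epsilon$, $\|b\|<\epsilon$, $\delta_\alpha(k)+i(bk-kb)=0$, and $\mathrm{Sp}(k)$ finite. Let $\ell^\infty$ be the $C^*$-algebra of bounded sequences in $A$, let $\ell^\infty_\alpha$ be the $C^*$-subalgebra of those $x=(x_n)\in\ell^\infty$ for which $t\mapsto(\alpha_t(x_n))_n$ is continuous for the sup norm, and let $c_0\subset\ell^\infty_\alpha$ be the ideal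 of sequences converging to zero. Let $A^\infty_\alpha=\ell^\infty_\alpha/c_0$, and denote again by $\alpha$ the flow on $A^\infty_\alpha$ induced by $(x_n)\mapsto(\alpha_t(x_n))$. Then the following conditions are equivalent: 1. Condition F0 holds. 2. The fixed point algebra $(A^\infty_\alpha)^\alpha=\{a\in A^\infty_\alpha : \alpha_t(a)=a \text{ for all } t\in\mathbb R\}$ has real rank zero. Here a unital $C^*$-algebra has real rank zero if its invertible self-adjoint elements are dense in its self-adjoint elements, and a non-unital $C^*$-algebra has real rank zero if its unitization does. -/

import Mathlib

open scoped ENNReal Topology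
open Filter

/-- A flow on a (not necessarily unital) C⋆-algebra `A`: a strongly continuous one-parameter group
of ⋆-automorphisms. Each `toFun t` is a ⋆-endomorphism, and it is an automorphism with inverse
`toFun (-t)` because of the group law. -/
structure CStarFlow (A : Type*) [NonUnitalCStarAlgebra A] where
  toFun : ℝ → (A →⋆ₙₐ[ℂ] A)
  map_zero' : ∀ a, toFun 0 a = a
  map_add' : ∀ s t a, toFun (s + t) a = toFun s (toFun t a)
  continuous' : ∀ a, Continuous fun t => toFun t a

/-- A (not necessarily unital) C⋆-algebra `B` has real rank zero if the invertible self-adjoint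
elements of its unitization are dense in the self-adjoint elements of the unitization.
`Unitization ℂ B` adjoins a new unit even if `B` has one; this makes no difference, see
`hasRealRankZero_iff_of_unital`. -/
def HasRealRankZero (B : Type*) [NonUnitalCStarAlgebra B] : Prop :=
  Dense {x : selfAdjoint (Unitization ℂ B) | IsUnit (x : Unitization ℂ B)}

/-- In the unital case real rank zero means that the invertible self-adjoint elements of the algebra
itself are dense in its self-adjoint elements. -/
theorem hasRealRankZero_iff_of_unital (B : Type*) [CStarAlgebra B] :
    HasRealRankZero B ↔ Dense {x : selfAdjoint B | IsUnit (x : B)} := by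
  have hsa : ∀ z : Unitization ℂ B, IsSelfAdjoint z ↔
      IsSelfAdjoint z.fst ∧ IsSelfAdjoint z.snd := by
    intro z
    simp [IsSelfAdjoint, Unitization.ext_iff]
  have hre : ∀ r : ℝ, IsSelfAdjoint ((r : ℂ) • (1 : B)) := fun r => by
    simp [IsSelfAdjoint]
  have hcs : ∀ c : ℂ, IsSelfAdjoint c → IsSelfAdjoint (c • (1 : B)) := fun c hc => by
    simp only [IsSelfAdjoint, star_smul, star_one, hc.star_eq]
  constructor
  · intro h
    let f : selfAdjoint (Unitization ℂ B) → selfAdjoint B := fun z =>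
      ⟨(z : Unitization ℂ B).fst • (1 : B) + (z : Unitization ℂ B).snd,
        (hcs _ ((hsa z).1 z.2).1).add ((hsa z).1 z.2).2⟩
    have hf : Continuous f := by
      refine Continuous.subtype_mk ?_ _
      exact ((Unitization.continuous_fst.comp continuous_subtype_val).smul continuous_const).add
        (Unitization.continuous_snd.comp continuous_subtype_val)
    have hs : Function.Surjective f := fun b =>
      ⟨⟨((b : B) : Unitization ℂ B), (hsa _).2 ⟨by simp, by simp⟩⟩,
        Subtype.ext (by simp [f])⟩
    refine (hs.denseRange.dense_image hf h).mono ?_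
    rintro _ ⟨z, hz, rfl⟩
    have hz : IsUnit (z : Unitization ℂ B) := hz
    have := hz.map (Unitization.lift (NonUnitalAlgHom.id ℂ B))
    simpa [f, Unitization.lift_apply, Algebra.algebraMap_eq_smul_one] using this
  · intro h
    let g : ℝ × selfAdjoint B → selfAdjoint (Unitization ℂ B) := fun p =>
      ⟨(⟨((p.1 : ℂ), (p.2 : B) - (p.1 : ℂ) • (1 : B))⟩ : Unitization ℂ B),
        (hsa _).2 ⟨Complex.conj_ofReal _, p.2.2.sub (hre _)⟩⟩
    have hg : Continuous g := by
      refine Continuous.subtype_mk ?_ _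
      exact Unitization.uniformEquivProd.symm.continuous.comp (by fun_prop :
        Continuous fun p : ℝ × selfAdjoint B => ((p.1 : ℂ), (p.2 : B) - (p.1 : ℂ) • (1 : B)))
    have hs : Function.Surjective g := fun z => by
      obtain ⟨h1, h2⟩ := (hsa _).1 z.2
      obtain ⟨r, hr⟩ := Complex.conj_eq_iff_real.1 h1
      refine ⟨(r, ⟨(z : Unitization ℂ B).snd + (r : ℂ) • (1 : B), h2.add (hre r)⟩), ?_⟩
      refine Subtype.ext (Unitization.ext ?_ ?_)
      · exact hr.symm
      · exact add_sub_cancel_right _ _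
    refine (hs.denseRange.dense_image hg
      (Dense.prod (dense_compl_singleton (0 : ℝ)) h)).mono ?_
    rintro _ ⟨⟨r, b⟩, ⟨hr, hb⟩, rfl⟩
    have hr : (r : ℂ) ≠ 0 := by simpa using hr
    obtain ⟨u, hu⟩ : IsUnit (b : B) := hb
    have e : ∀ (c d : ℂ) (v w : B), c * d = 1 → v * w = 1 →
        (⟨(c, v - c • (1 : B))⟩ * ⟨(d, w - d • (1 : B))⟩ : Unitization ℂ B) = 1 := by
      intro c d v w hcd hvw
      refine Unitization.ext hcd ?_
      show c • (w - d • (1 : B)) + d • (v - c • (1 : B))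
        + (v - c • (1 : B)) * (w - d • (1 : B)) = 0
      simp only [smul_sub, sub_mul, mul_sub, hvw, smul_smul, hcd, mul_comm d c, smul_mul_assoc,
        mul_smul_comm, one_mul, mul_one, one_smul]
      abel
    refine ⟨⟨⟨((r : ℂ), (b : B) - (r : ℂ) • (1 : B))⟩,
      ⟨((r : ℂ)⁻¹, (↑u⁻¹ : B) - (r : ℂ)⁻¹ • (1 : B))⟩, ?_, ?_⟩, rfl⟩
    · exact e _ _ _ _ (mul_inv_cancel₀ hr) (by rw [← hu]; exact u.mul_inv)
    · exact e _ _ _ _ (inv_mul_cancel₀ hr) (by rw [← hu]; exact u.inv_mul)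

namespace CStarFlow

noncomputable section

variable {A : Type*} [NonUnitalCStarAlgebra A] (α : CStarFlow A)

instance : CoeFun (CStarFlow A) (fun _ => ℝ → (A →⋆ₙₐ[ℂ] A)) := ⟨CStarFlow.toFun⟩

theorem norm_apply (t : ℝ) (a : A) : ‖α t a‖ = ‖a‖ := by
  refine NonUnitalStarAlgHom.norm_map (α t) (fun x y h => ?_) a
  rw [← α.map_zero' x, ← α.map_zero' y, ← neg_add_cancel t, α.map_add', α.map_add', h]

/-- The domain of the generator of the flow. -/
def domain : Set A := {x | DifferentiableAt ℝ (fun t : ℝ => α t x) 0}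

/-- The generator `δ_α` of the flow, `δ_α x = d/dt α_t(x)` at `t = 0`.
It is only meaningful for `x ∈ α.domain`. -/
def generator (x : A) : A := deriv (fun t : ℝ => α t x) 0

/-- Condition F0. Here `(δ_α + ad ib)(k) = δ_α(k) + i (b k - k b)`, and the spectrum of `k` is taken
in the unitization (that is the quasispectrum; if `A` is unital then it differs from the spectrum at
most by the point `0`, so that its finiteness has the usual meaning). -/
def ConditionF0 : Prop :=
  ∀ ε : ℝ, 0 < ε → ∃ ν : ℝ, 0 < ν ∧
    ∀ h : A, IsSelfAdjoint h → h ∈ α.domain → ‖h‖ ≤ 1 → ‖α.generator h‖ < ν →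
      ∃ k b : A, IsSelfAdjoint k ∧ k ∈ α.domain ∧ IsSelfAdjoint b ∧
        ‖h - k‖ < ε ∧ ‖b‖ < ε ∧
        α.generator k + Complex.I • (b * k - k * b) = 0 ∧
        (quasispectrum ℂ k).Finite

/-- The fixed point algebra of a flow. -/
def fixedPoints : NonUnitalStarSubalgebra ℂ A where
  carrier := {a | ∀ t, α t a = a}
  add_mem' ha hb t := by rw [map_add, ha t, hb t]
  zero_mem' t := map_zero _
  mul_mem' ha hb t := by rw [map_mul, ha t, hb t]
  smul_mem' c a ha t := by rw [map_smul, ha t]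
  star_mem' ha t := by rw [map_star, ha t]

instance isClosed_fixedPoints : IsClosed (α.fixedPoints : Set A) := by
  have : (α.fixedPoints : Set A) = ⋂ t, {a | α t a = a} := by
    ext a
    rw [Set.mem_iInter]
    exact Iff.rfl
  rw [this]
  exact isClosed_iInter fun t => isClosed_eq
    (AddMonoidHomClass.isometry_of_norm (α t) (α.norm_apply t)).continuous continuous_id

/-- The C⋆-algebra `ℓ^∞` of bounded sequences in `A`, with the sup norm. -/
abbrev BddSeq (A : Type*) [NonUnitalCStarAlgebra A] : Type _ := lp (fun _ : ℕ => A) ∞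

/-- The action `(x_n) ↦ (α_t(x_n))` on bounded sequences. It is in general not strongly continuous
in `t`. -/
def seqMap (t : ℝ) : BddSeq A →⋆ₙₐ[ℂ] BddSeq A where
  toFun x := ⟨fun n => α t (x n), memℓp_infty (by
    simpa only [α.norm_apply] using (lp.memℓp x).bddAbove)⟩
  map_smul' c x := by ext n; exact map_smul (α t) c (x n)
  map_zero' := by ext n; exact map_zero (α t)
  map_add' x y := by ext n; exact map_add (α t) (x n) (y n)
  map_mul' x y := by ext n; exact map_mul (α t) (x n) (y n)
  map_star' x := by ext n; exact map_star (α t) (x n)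

@[simp] theorem seqMap_apply (t : ℝ) (x : BddSeq A) (n : ℕ) : α.seqMap t x n = α t (x n) := rfl

theorem norm_seqMap (t : ℝ) (x : BddSeq A) : ‖α.seqMap t x‖ = ‖x‖ := by
  simp only [lp.norm_eq_ciSup, seqMap_apply, norm_apply]

theorem seqMap_add (s t : ℝ) (x : BddSeq A) :
    α.seqMap (s + t) x = α.seqMap s (α.seqMap t x) := by
  ext n; exact α.map_add' s t (x n)

/-- The C⋆-algebra `ℓ^∞_α` of the bounded sequences `x` for which `t ↦ (α_t(x_n))_n` is continuous
for the sup norm. -/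
def contSeq : NonUnitalStarSubalgebra ℂ (BddSeq A) where
  carrier := {x | Continuous fun t => α.seqMap t x}
  add_mem' {x y} hx hy := by
    simp only [Set.mem_ofPred_eq, map_add] at *
    exact hx.add hy
  zero_mem' := by
    simp only [Set.mem_ofPred_eq, map_zero]
    exact continuous_const
  mul_mem' {x y} hx hy := by
    simp only [Set.mem_ofPred_eq, map_mul] at *
    exact hx.mul hy
  smul_mem' c x hx := by
    simp only [Set.mem_ofPred_eq, map_smul] at *
    exact hx.const_smul c
  star_mem' {x} hx := by
    simp only [Set.mem_ofPred_eq, map_star] at *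
    exact hx.star

theorem mem_contSeq {x : BddSeq A} : x ∈ α.contSeq ↔ Continuous fun t => α.seqMap t x := Iff.rfl

instance isClosed_contSeq : IsClosed (α.contSeq : Set (BddSeq A)) := by
  refine isClosed_of_closure_subset fun x hx => ?_
  rw [SetLike.mem_coe, mem_contSeq]
  refine continuous_of_uniform_approx_of_continuous fun u hu => ?_
  obtain ⟨ε, hε, hu⟩ := Metric.mem_uniformity_dist.1 hu
  obtain ⟨y, hy, hxy⟩ := Metric.mem_closure_iff.1 hx ε hε
  refine ⟨_, hy, fun t => hu ?_⟩
  rwa [dist_eq_norm, ← map_sub, norm_seqMap, ← dist_eq_norm]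

/-- The ideal `c_0` of the sequences converging to zero, inside `ℓ^∞_α`. See
`mem_contSeq_of_tendsto` for the fact that `ℓ^∞_α` contains all sequences converging to zero. -/
def nullSeq : Submodule ℂ α.contSeq where
  carrier := {x | Tendsto (fun n => (x : BddSeq A) n) atTop (𝓝 0)}
  add_mem' {x y} hx hy := by simpa using Tendsto.add hx hy
  zero_mem' := by
    show Tendsto (fun _ : ℕ => (0 : A)) atTop (𝓝 0)
    exact tendsto_const_nhds
  smul_mem' c x hx := by simpa using Tendsto.const_smul hx c

theorem mem_nullSeq {x : α.contSeq} :
    x ∈ α.nullSeq ↔ Tendsto (fun n => (x : BddSeq A) n) atTop (𝓝 0) := Iff.rfl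

theorem single_mem_contSeq (i : ℕ) (a : A) :
    (lp.single ∞ i a : BddSeq A) ∈ α.contSeq := by
  have h : ∀ t, α.seqMap t (lp.single ∞ i a) = lp.single ∞ i (α t a) := by
    intro t
    ext n
    rw [seqMap_apply]
    by_cases hn : n = i
    · subst hn
      simp
    · simp [hn]
  rw [mem_contSeq]
  simp only [h]
  rw [Metric.continuous_iff']
  intro t ε hε
  filter_upwards [Metric.continuous_iff'.1 (α.continuous' a) t ε hε] with s hs
  rw [dist_eq_norm, ← lp.single_sub, lp.norm_single (by simp), ← dist_eq_norm]
  exact hs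

/-- Every bounded sequence is, up to a finitely supported one, which lies in `ℓ^∞_α`, as small as
its tail. -/
theorem exists_head (x : BddSeq A) {r : ℝ} (hr : 0 ≤ r) (hx : ∀ᶠ n in atTop, ‖x n‖ ≤ r) :
    ∃ y ∈ α.contSeq, Tendsto (fun n => y n) atTop (𝓝 0) ∧ ‖x - y‖ ≤ r := by
  obtain ⟨N, hN⟩ := eventually_atTop.1 hx
  have happ : ∀ n, (∑ i ∈ Finset.range N, lp.single ∞ i (x i) : BddSeq A) n
      = if n < N then x n else 0 := by
    intro n
    rw [lp.coeFn_sum, Finset.sum_apply]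
    simp only [lp.single_apply, Pi.single_apply]
    simp
  refine ⟨∑ i ∈ Finset.range N, lp.single ∞ i (x i),
    sum_mem fun i _ => α.single_mem_contSeq i _, ?_, ?_⟩
  · refine tendsto_const_nhds.congr' ?_
    filter_upwards [eventually_ge_atTop N] with n hn
    rw [happ, if_neg hn.not_gt]
  · refine lp.norm_le_of_forall_le hr fun n => ?_
    rw [lp.coeFn_sub, Pi.sub_apply, happ]
    split_ifs with h
    · simpa using hr
    · simpa using hN n (not_lt.1 h)

theorem mem_contSeq_of_tendsto {x : BddSeq A} (hx : Tendsto (fun n => x n) atTop (𝓝 0)) :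
    x ∈ α.contSeq := by
  have : x ∈ closure (α.contSeq : Set (BddSeq A)) := by
    refine Metric.mem_closure_iff.2 fun ε hε => ?_
    obtain ⟨y, hy, -, hxy⟩ := α.exists_head x (half_pos hε).le (by
      filter_upwards [Metric.tendsto_nhds.1 hx _ (half_pos hε)] with n hn
      simpa using hn.le)
    exact ⟨y, hy, by rw [dist_eq_norm]; linarith⟩
  rwa [α.isClosed_contSeq.closure_eq] at this

instance isClosed_nullSeq : IsClosed (α.nullSeq : Set α.contSeq) := by
  refine isClosed_of_closure_subset fun x hx => ?_
  rw [SetLike.mem_coe, mem_nullSeq, Metric.tendsto_nhds]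
  intro ε hε
  obtain ⟨y, hy, hxy⟩ := Metric.mem_closure_iff.1 hx (ε / 2) (half_pos hε)
  filter_upwards [Metric.tendsto_nhds.1 (α.mem_nullSeq.1 hy) _ (half_pos hε)] with n hn
  have h1 := lp.norm_apply_le_norm ENNReal.top_ne_zero ((x - y : α.contSeq) : BddSeq A) n
  have h2 : ‖((x - y : α.contSeq) : BddSeq A)‖ < ε / 2 := by rwa [dist_eq_norm] at hxy
  have h3 : ((x - y : α.contSeq) : BddSeq A) n = (x : BddSeq A) n - (y : BddSeq A) n := rfl
  rw [h3] at h1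
  rw [dist_zero_right] at hn ⊢
  have := norm_le_norm_sub_add ((x : BddSeq A) n) ((y : BddSeq A) n)
  linarith

theorem mul_mem_nullSeq_left (x : α.contSeq) {y : α.contSeq} (hy : y ∈ α.nullSeq) :
    x * y ∈ α.nullSeq := by
  refine squeeze_zero_norm (a := fun n => ‖(x : BddSeq A)‖ * ‖(y : BddSeq A) n‖) (fun n => ?_)
    (by simpa using (tendsto_norm_zero.comp (α.mem_nullSeq.1 hy)).const_mul ‖(x : BddSeq A)‖)
  refine (norm_mul_le ((x : BddSeq A) n) ((y : BddSeq A) n)).trans ?_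
  gcongr
  exact lp.norm_apply_le_norm ENNReal.top_ne_zero _ n

theorem star_mem_nullSeq {x : α.contSeq} (hx : x ∈ α.nullSeq) : star x ∈ α.nullSeq := by
  rw [mem_nullSeq] at *
  simpa using hx.star

theorem mul_mem_nullSeq_right {x : α.contSeq} (hx : x ∈ α.nullSeq) (y : α.contSeq) :
    x * y ∈ α.nullSeq := by
  simpa using α.star_mem_nullSeq (α.mul_mem_nullSeq_left (star y) (α.star_mem_nullSeq hx))

/-- The C⋆-algebra `A^∞_α = ℓ^∞_α / c_0`, with the quotient norm. -/
def AsympAlg : Type _ := α.contSeq ⧸ α.nullSeq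

namespace AsympAlg

instance : NormedAddCommGroup α.AsympAlg :=
  inferInstanceAs (NormedAddCommGroup (α.contSeq ⧸ α.nullSeq))

instance : NormedSpace ℂ α.AsympAlg :=
  inferInstanceAs (NormedSpace ℂ (α.contSeq ⧸ α.nullSeq))

instance : CompleteSpace α.AsympAlg :=
  inferInstanceAs (CompleteSpace (α.contSeq ⧸ α.nullSeq))

variable {α} in
/-- The quotient map `ℓ^∞_α → A^∞_α`. -/
def mk : α.contSeq →ₗ[ℂ] α.AsympAlg := α.nullSeq.mkQ

theorem mk_surjective : Function.Surjective (mk (α := α)) := α.nullSeq.mkQ_surjective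

theorem mk_eq_mk {x y : α.contSeq} : mk x = mk y ↔ x - y ∈ α.nullSeq :=
  Submodule.Quotient.eq α.nullSeq

/-- The product of `A^∞_α`, induced by the termwise product of sequences. -/
instance : Mul α.AsympAlg where
  mul := Quotient.map₂ (· * ·) fun x x' hx y y' hy => by
    have hx' := (Submodule.quotientRel_def _).1 hx
    have hy' := (Submodule.quotientRel_def _).1 hy
    refine (Submodule.quotientRel_def _).2 ?_
    have : x * y - x' * y' = (x - x') * y + x' * (y - y') := by
      rw [sub_mul, mul_sub]; abel
    rw [this]
    exact add_mem (α.mul_mem_nullSeq_right hx' y) (α.mul_mem_nullSeq_left x' hy')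

/-- The involution of `A^∞_α`, induced by the termwise involution of sequences. -/
instance : Star α.AsympAlg where
  star := Quotient.map star fun x x' hx => by
    have hx' := (Submodule.quotientRel_def _).1 hx
    refine (Submodule.quotientRel_def _).2 ?_
    have h : star x - star x' = star (x - x') := (star_sub x x').symm
    rw [h]
    exact α.star_mem_nullSeq hx'

theorem mk_mul (x y : α.contSeq) : mk (x * y) = mk x * mk y := rfl

theorem mk_star (x : α.contSeq) : mk (star x) = star (mk x) := rfl

theorem norm_mk_le {x : α.contSeq} : ‖mk x‖ ≤ ‖x‖ :=
  QuotientAddGroup.norm_mk_le_norm (S := α.nullSeq.toAddSubgroup)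

theorem norm_mk_lt_iff {z : α.AsympAlg} {r : ℝ} : ‖z‖ < r ↔ ∃ x, mk x = z ∧ ‖x‖ < r :=
  QuotientAddGroup.norm_lt_iff (S := α.nullSeq.toAddSubgroup)

/-- The quotient norm of `A^∞_α` is `limsup ‖x_n‖`: lower bound. -/
theorem eventually_norm_lt {x : α.contSeq} {r : ℝ} (h : ‖mk x‖ < r) :
    ∀ᶠ n in atTop, ‖(x : BddSeq A) n‖ < r := by
  obtain ⟨s, hs, hsr⟩ := exists_between h
  obtain ⟨y, hy, hys⟩ := (norm_mk_lt_iff α).1 hs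
  have hxy := α.mem_nullSeq.1 ((mk_eq_mk α).1 hy.symm)
  filter_upwards [Metric.tendsto_nhds.1 hxy (r - s) (by linarith)] with n hn
  rw [dist_zero_right] at hn
  have h1 := lp.norm_apply_le_norm ENNReal.top_ne_zero (y : BddSeq A) n
  have h2 : ‖(y : BddSeq A)‖ < s := hys
  have h3 := norm_le_norm_sub_add ((x : BddSeq A) n) ((y : BddSeq A) n)
  have h4 : ‖(x : BddSeq A) n - (y : BddSeq A) n‖ < r - s := hn
  linarith

/-- The quotient norm of `A^∞_α` is `limsup ‖x_n‖`: upper bound. -/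
theorem norm_mk_le_of_eventually {x : α.contSeq} {r : ℝ} (hr : 0 ≤ r)
    (h : ∀ᶠ n in atTop, ‖(x : BddSeq A) n‖ ≤ r) : ‖mk x‖ ≤ r := by
  obtain ⟨y, hy, hy0, hxy⟩ := α.exists_head x hr h
  have : mk x = mk (x - ⟨y, hy⟩) := by
    rw [mk_eq_mk, sub_sub_cancel]
    exact hy0
  rw [this]
  exact (norm_mk_le α).trans hxy

instance : NonUnitalNormedRing α.AsympAlg :=
  { (inferInstance : NormedAddCommGroup α.AsympAlg) with
    mul := (· * ·)
    left_distrib := by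
      intro x y z
      obtain ⟨x, rfl⟩ := mk_surjective α x
      obtain ⟨y, rfl⟩ := mk_surjective α y
      obtain ⟨z, rfl⟩ := mk_surjective α z
      exact congrArg mk (mul_add x y z)
    right_distrib := by
      intro x y z
      obtain ⟨x, rfl⟩ := mk_surjective α x
      obtain ⟨y, rfl⟩ := mk_surjective α y
      obtain ⟨z, rfl⟩ := mk_surjective α z
      exact congrArg mk (add_mul x y z)
    zero_mul := by
      intro x
      obtain ⟨x, rfl⟩ := mk_surjective α x
      exact congrArg mk (zero_mul x)
    mul_zero := by
      intro x
      obtain ⟨x, rfl⟩ := mk_surjective α x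
      exact congrArg mk (mul_zero x)
    mul_assoc := by
      intro x y z
      obtain ⟨x, rfl⟩ := mk_surjective α x
      obtain ⟨y, rfl⟩ := mk_surjective α y
      obtain ⟨z, rfl⟩ := mk_surjective α z
      exact congrArg mk (mul_assoc x y z)
    norm_mul_le := by
      intro z w
      refine le_of_forall_pos_le_add fun ε hε => ?_
      have hcont : Tendsto (fun d : ℝ => (‖z‖ + d) * (‖w‖ + d)) (𝓝[>] 0) (𝓝 (‖z‖ * ‖w‖)) := by
        have : Continuous fun d : ℝ => (‖z‖ + d) * (‖w‖ + d) := by fun_prop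
        simpa using (this.tendsto 0).mono_left nhdsWithin_le_nhds
      obtain ⟨d, hd, hd0⟩ := ((hcont.eventually (gt_mem_nhds
        (show ‖z‖ * ‖w‖ < ‖z‖ * ‖w‖ + ε by linarith))).and self_mem_nhdsWithin).exists
      have hd0 : 0 < d := hd0
      obtain ⟨x, rfl, hx⟩ := (norm_mk_lt_iff α).1 (lt_add_of_pos_right ‖z‖ hd0)
      obtain ⟨y, rfl, hy⟩ := (norm_mk_lt_iff α).1 (lt_add_of_pos_right ‖w‖ hd0)
      calc ‖mk (x * y)‖ ≤ ‖x * y‖ := norm_mk_le α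
        _ ≤ ‖x‖ * ‖y‖ := norm_mul_le x y
        _ ≤ (‖mk x‖ + d) * (‖mk y‖ + d) := by gcongr
        _ ≤ ‖mk x‖ * ‖mk y‖ + ε := hd.le }

instance : StarRing α.AsympAlg where
  star_involutive := by
    intro x
    obtain ⟨x, rfl⟩ := mk_surjective α x
    exact congrArg mk (star_star x)
  star_mul := by
    intro x y
    obtain ⟨x, rfl⟩ := mk_surjective α x
    obtain ⟨y, rfl⟩ := mk_surjective α y
    exact congrArg mk (star_mul x y)
  star_add := by
    intro x y
    obtain ⟨x, rfl⟩ := mk_surjective α x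
    obtain ⟨y, rfl⟩ := mk_surjective α y
    exact congrArg mk (star_add x y)

instance : NonUnitalCStarAlgebra α.AsympAlg :=
  { (inferInstance : NonUnitalNormedRing α.AsympAlg),
    (inferInstance : StarRing α.AsympAlg),
    (inferInstance : NormedSpace ℂ α.AsympAlg),
    (inferInstance : CompleteSpace α.AsympAlg) with
    norm_mul_self_le := by
      intro z
      obtain ⟨x, rfl⟩ := mk_surjective α z
      have key : ∀ ε > 0, ‖mk x‖ ≤ √(‖star (mk x) * mk x‖ + ε) := by
        intro ε hε
        refine norm_mk_le_of_eventually α (Real.sqrt_nonneg _) ?_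
        have h : ‖mk (star x * x)‖ < ‖star (mk x) * mk x‖ + ε := lt_add_of_pos_right _ hε
        filter_upwards [eventually_norm_lt α h] with n hn
        refine Real.le_sqrt_of_sq_le ?_
        rw [sq, ← CStarRing.norm_star_mul_self]
        exact hn.le
      refine le_of_forall_pos_le_add fun ε hε => ?_
      have h := key ε hε
      rw [Real.le_sqrt (norm_nonneg _) (by positivity), sq] at h
      exact h
    smul_assoc := by
      intro c x y
      obtain ⟨x, rfl⟩ := mk_surjective α x
      obtain ⟨y, rfl⟩ := mk_surjective α y
      exact congrArg mk (smul_mul_assoc c x y)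
    smul_comm := by
      intro c x y
      obtain ⟨x, rfl⟩ := mk_surjective α x
      obtain ⟨y, rfl⟩ := mk_surjective α y
      exact congrArg mk (mul_smul_comm c x y).symm
    star_smul := by
      intro c x
      obtain ⟨x, rfl⟩ := mk_surjective α x
      exact congrArg mk (star_smul c x) }

end AsympAlg

/-- The flow on `ℓ^∞_α` obtained by restricting `(x_n) ↦ (α_t(x_n))`. -/
def contSeqFlow : CStarFlow α.contSeq where
  toFun t :=
    { toFun := fun x => ⟨α.seqMap t x, by
        have h := (α.mem_contSeq.1 x.2).comp (continuous_id.add (continuous_const (y := t)))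
        refine α.mem_contSeq.2 (h.congr fun s => ?_)
        exact α.seqMap_add s t x⟩
      map_smul' := fun c x => Subtype.ext (map_smul (α.seqMap t) c (x : BddSeq A))
      map_zero' := Subtype.ext (map_zero (α.seqMap t))
      map_add' := fun x y => Subtype.ext (map_add (α.seqMap t) (x : BddSeq A) y)
      map_mul' := fun x y => Subtype.ext (map_mul (α.seqMap t) (x : BddSeq A) y)
      map_star' := fun x => Subtype.ext (map_star (α.seqMap t) (x : BddSeq A)) }
  map_zero' x := by
    refine Subtype.ext ?_
    ext n
    exact α.map_zero' _
  map_add' s t x := Subtype.ext (α.seqMap_add s t x)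
  continuous' x := Continuous.subtype_mk (α.mem_contSeq.1 x.2) _

theorem contSeqFlow_apply (t : ℝ) (x : α.contSeq) (n : ℕ) :
    (α.contSeqFlow t x : BddSeq A) n = α t ((x : BddSeq A) n) := rfl

theorem contSeqFlow_mem_nullSeq (t : ℝ) {x : α.contSeq} (hx : x ∈ α.nullSeq) :
    α.contSeqFlow t x ∈ α.nullSeq := by
  rw [mem_nullSeq, tendsto_zero_iff_norm_tendsto_zero] at *
  simpa only [contSeqFlow_apply, norm_apply] using hx

/-- The map `[(x_n)] ↦ [(α_t(x_n))]` on `A^∞_α`. -/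
def asympMap (t : ℝ) : α.AsympAlg → α.AsympAlg :=
  Quotient.map (α.contSeqFlow t) fun x x' hx => by
    have hx' := (Submodule.quotientRel_def _).1 hx
    refine (Submodule.quotientRel_def _).2 ?_
    rw [← map_sub]
    exact α.contSeqFlow_mem_nullSeq t hx'

theorem asympMap_mk (t : ℝ) (x : α.contSeq) :
    α.asympMap t (AsympAlg.mk x) = AsympAlg.mk (α.contSeqFlow t x) := rfl

/-- `asympMap` as a ⋆-homomorphism. -/
def asympHom (t : ℝ) : α.AsympAlg →⋆ₙₐ[ℂ] α.AsympAlg where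
  toFun := α.asympMap t
  map_smul' := by
    intro c x
    obtain ⟨x, rfl⟩ := AsympAlg.mk_surjective α x
    rw [← map_smul, asympMap_mk, asympMap_mk, map_smul, map_smul]
    rfl
  map_zero' := by
    rw [← map_zero (AsympAlg.mk (α := α)), asympMap_mk, map_zero]
  map_add' := by
    intro x y
    obtain ⟨x, rfl⟩ := AsympAlg.mk_surjective α x
    obtain ⟨y, rfl⟩ := AsympAlg.mk_surjective α y
    rw [← map_add, asympMap_mk, asympMap_mk, asympMap_mk, map_add, map_add]
  map_mul' := by
    intro x y
    obtain ⟨x, rfl⟩ := AsympAlg.mk_surjective α x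
    obtain ⟨y, rfl⟩ := AsympAlg.mk_surjective α y
    rw [← AsympAlg.mk_mul, asympMap_mk, asympMap_mk, asympMap_mk, map_mul, AsympAlg.mk_mul]
  map_star' := by
    intro x
    obtain ⟨x, rfl⟩ := AsympAlg.mk_surjective α x
    rw [← AsympAlg.mk_star, asympMap_mk, asympMap_mk, map_star, AsympAlg.mk_star]

theorem asympHom_mk (t : ℝ) (x : α.contSeq) :
    α.asympHom t (AsympAlg.mk x) = AsympAlg.mk (α.contSeqFlow t x) := rfl

theorem continuous_mk : Continuous (AsympAlg.mk (α := α)) :=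
  AddMonoidHomClass.continuous_of_bound _ 1 fun y => by
    rw [one_mul]; exact AsympAlg.norm_mk_le α

/-- The flow on `A^∞_α` induced by `α`, `[(x_n)] ↦ [(α_t(x_n))]`. -/
def asympFlow : CStarFlow α.AsympAlg where
  toFun := α.asympHom
  map_zero' x := by
    obtain ⟨x, rfl⟩ := AsympAlg.mk_surjective α x
    rw [asympHom_mk, α.contSeqFlow.map_zero']
  map_add' s t x := by
    obtain ⟨x, rfl⟩ := AsympAlg.mk_surjective α x
    rw [asympHom_mk, asympHom_mk, asympHom_mk, α.contSeqFlow.map_add']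
  continuous' x := by
    obtain ⟨x, rfl⟩ := AsympAlg.mk_surjective α x
    simp only [asympHom_mk]
    exact α.continuous_mk.comp (α.contSeqFlow.continuous' x)

theorem asympFlow_mk (t : ℝ) (x : α.contSeq) :
    α.asympFlow t (AsympAlg.mk x) = AsympAlg.mk (α.contSeqFlow t x) := rfl

end

end CStarFlow

/-! The link between the two conditions is that self-adjoint fixed points of the flow on `A^∞_α` are
the classes of bounded self-adjoint sequences `h_n` in the domain with `δ(h_n) → 0`. A bounded
sequence with `δ(h_n) → 0` is uniformly Lipschitz along orbits and represents a fixed point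
(`exists_contSeq_of_generator_tendsto`). Conversely, averaging a lift over the orbit segment `[0,
1]` makes it differentiable without changing its class (`exists_domain_lift`).

From F0 to real rank zero: lift a fixed point and apply F0 along the sequence. This gives `k_n` of
finite spectrum, close to `h_n` and annihilated by `δ + ad(ib_n)` with `b_n → 0`. Every function of
an element of finite spectrum is a polynomial in it, and a derivation that kills an element kills
its polynomials. Hence the spectrum may be pushed away from `0`. The resulting elements and their
inverses are bounded and annihilated by `δ + ad(ib_n)`, so they represent fixed points. This is an
invertible approximant.

From real rank zero to F0: if F0 fails for some `ε`, a sequence of counterexamples represents a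
self-adjoint fixed point. By Baire it is close to one whose spectrum misses every midpoint `η(j +
1/2)`. Cutting off finitely many entries yields a differentiable lift `H` with the same gaps
(`exists_lift_avoiding`). The spectral projections `p_j` of `H` between gaps lie in the domain,
because it is stable under inverses and under square roots of invertible positive elements. With `d
= ∑ δ(p_j) p_j` one has `δ(p_j) = d p_j - p_j d` and `d* = -d`, so `b = i d` is self-adjoint and `δ
+ ad(ib)` kills the `p_j`, hence also `k = ∑ η j p_j`. The `p_j` become fixed modulo `c_0`, so `b`
lies in `c_0`. A late entry of `k` and `b` contradicts the choice of the sequence. -/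

namespace NonUnitalStarAlgHom

variable {A B : Type*} [NonUnitalCStarAlgebra A] [NonUnitalCStarAlgebra B]

theorem continuous_of_cstar (π : A →⋆ₙₐ[ℂ] B) : Continuous π :=
  AddMonoidHomClass.continuous_of_bound π 1 fun a => by
    rw [one_mul]; exact NonUnitalStarAlgHom.norm_apply_le π a

/-- A ⋆-homomorphism of C⋆-algebras as a continuous real linear map. -/
noncomputable def toRealCLM (π : A →⋆ₙₐ[ℂ] B) : A →L[ℝ] B where
  toFun := π
  map_add' := map_add π
  map_smul' r x := by
    rw [← Complex.coe_smul, map_smul, Complex.coe_smul]; rfl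
  cont := π.continuous_of_cstar

@[simp] theorem toRealCLM_apply (π : A →⋆ₙₐ[ℂ] B) (x : A) : π.toRealCLM x = π x := rfl

end NonUnitalStarAlgHom

/-! ### Calculus of the generator and orbit means. -/

namespace CStarFlow

section Generator

variable {A : Type*} [NonUnitalCStarAlgebra A] (α : CStarFlow A)

variable {α} in
theorem hasDerivAt_zero {x : A} (hx : x ∈ α.domain) :
    HasDerivAt (fun t : ℝ => α t x) (α.generator x) 0 :=
  DifferentiableAt.hasDerivAt hx

variable {α} in
theorem mem_domain_of_hasDerivAt {x y : A} (h : HasDerivAt (fun t : ℝ => α t x) y 0) :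
    x ∈ α.domain := h.differentiableAt

variable {α} in
theorem generator_eq {x y : A} (h : HasDerivAt (fun t : ℝ => α t x) y 0) :
    α.generator x = y := h.deriv

theorem zero_mem_domain : (0 : A) ∈ α.domain :=
  mem_domain_of_hasDerivAt (y := 0) (by simpa using hasDerivAt_const (0 : ℝ) (0 : A))

theorem generator_zero : α.generator 0 = 0 :=
  generator_eq (by simpa using hasDerivAt_const (0 : ℝ) (0 : A))

theorem hasDerivAt_add {x y : A} (hx : x ∈ α.domain) (hy : y ∈ α.domain) :
    HasDerivAt (fun t : ℝ => α t (x + y)) (α.generator x + α.generator y) 0 := by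
  simpa only [map_add] using (hasDerivAt_zero hx).fun_add (hasDerivAt_zero hy)

theorem hasDerivAt_smul (c : ℂ) {x : A} (hx : x ∈ α.domain) :
    HasDerivAt (fun t : ℝ => α t (c • x)) (c • α.generator x) 0 := by
  simpa only [map_smul] using (hasDerivAt_zero hx).fun_const_smul c

theorem hasDerivAt_map {B : Type*} [NonUnitalCStarAlgebra B] {β : CStarFlow B}
    (π : A →⋆ₙₐ[ℂ] B) (hπ : ∀ t x, π (α t x) = β t (π x)) {x : A} (hx : x ∈ α.domain) :
    HasDerivAt (fun t : ℝ => β t (π x)) (π (α.generator x)) 0 := by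
  simp only [← hπ]
  exact π.toRealCLM.hasFDerivAt.comp_hasDerivAt (0 : ℝ) (hasDerivAt_zero hx)

theorem hasDerivAt_star {x : A} (hx : x ∈ α.domain) :
    HasDerivAt (fun t : ℝ => α t (star x)) (star (α.generator x)) 0 := by
  simpa only [map_star] using (hasDerivAt_zero hx).star

theorem hasDerivAt_sum {ι : Type*} (s : Finset ι) {x : ι → A} (hx : ∀ i ∈ s, x i ∈ α.domain) :
    HasDerivAt (fun t : ℝ => α t (∑ i ∈ s, x i)) (∑ i ∈ s, α.generator (x i)) 0 := by
  simpa only [map_sum] using HasDerivAt.fun_sum fun i hi => hasDerivAt_zero (hx i hi)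

theorem hasDerivAt {x : A} (hx : x ∈ α.domain) (t : ℝ) :
    HasDerivAt (fun s : ℝ => α s x) (α t (α.generator x)) t := by
  have h := (α t).toRealCLM.hasFDerivAt.comp_hasDerivAt (0 : ℝ) (hasDerivAt_zero hx)
  have h2 : HasDerivAt (fun s : ℝ => α t (α s x)) (α t (α.generator x)) (t - t) := by
    rw [sub_self]; exact h
  have h3 := HasDerivAt.comp_sub_const t t h2
  refine h3.congr_of_eventuallyEq (Eventually.of_forall fun s => ?_)
  show α s x = α t (α (s - t) x)
  rw [← α.map_add', add_sub_cancel]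

/-- The derivative of the orbit at `t` is `α_t(δ x)`, which has the constant norm `‖δ x‖`. This
turns smallness of the generator into almost invariance. -/
theorem norm_apply_sub_le {x : A} (hx : x ∈ α.domain) (s t : ℝ) :
    ‖α t x - α s x‖ ≤ ‖α.generator x‖ * |t - s| := by
  have := Convex.norm_image_sub_le_of_norm_hasDerivWithin_le (s := Set.univ)
    (f := fun s : ℝ => α s x) (f' := fun t => α t (α.generator x)) (C := ‖α.generator x‖)
    (fun t _ => (α.hasDerivAt hx t).hasDerivWithinAt) (fun t _ => (α.norm_apply _ _).le)
    convex_univ (Set.mem_univ s) (Set.mem_univ t)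
  simpa using this

theorem generator_eq_zero_of_fixed {x : A} (hx : ∀ t, α t x = x) : α.generator x = 0 :=
  generator_eq (by simpa only [hx] using hasDerivAt_const (0 : ℝ) x)

/-- The mean of an orbit over `[0, 1]`. -/
noncomputable def mean (x : A) : A := ∫ t in (0 : ℝ)..1, α t x

/-- Translating the mean by `α_s` moves the interval of integration to `[s, 1 + s]`, so the
fundamental theorem of calculus gives the derivative `α_1 x - x` at `0`. -/
theorem mean_mem_domain (x : A) : α.mean x ∈ α.domain := by
  have hc := α.continuous' x
  have hi : ∀ a b : ℝ, IntervalIntegrable (fun t => α t x) MeasureTheory.volume a b :=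
    fun a b => hc.intervalIntegrable a b
  have key : ∀ s : ℝ, α s (α.mean x)
      = (∫ t in (0 : ℝ)..(1 + s), α t x) - ∫ t in (0 : ℝ)..s, α t x := by
    intro s
    have h1 := (α s).toRealCLM.intervalIntegral_comp_comm (hi 0 1)
    rw [intervalIntegral.integral_interval_sub_left (hi _ _) (hi _ _)]
    refine h1.symm.trans ?_
    have : ∀ t, (α s).toRealCLM (α t x) = α (t + s) x := fun t => by
      rw [add_comm, α.map_add']; rfl
    simp only [this]
    rw [intervalIntegral.integral_comp_add_right (fun t => α t x) s, zero_add]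
  refine mem_domain_of_hasDerivAt (y := α 1 x - α 0 x) ?_
  simp only [key]
  have hd : ∀ t : ℝ, HasDerivAt (fun u => ∫ s in (0 : ℝ)..u, α s x) (α t x) t := fun t =>
    intervalIntegral.integral_hasDerivAt_right (hi _ _)
      hc.stronglyMeasurable.stronglyMeasurableAtFilter hc.continuousAt
  refine HasDerivAt.fun_sub ?_ (hd 0)
  have := hd (1 + 0)
  rw [add_zero] at this
  simpa using HasDerivAt.comp_const_add (1 : ℝ) 0 (by simpa using this)

theorem map_mean {B : Type*} [NonUnitalCStarAlgebra B] {β : CStarFlow B}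
    (π : A →⋆ₙₐ[ℂ] B) (hπ : ∀ t x, π (α t x) = β t (π x)) (x : A) :
    π (α.mean x) = β.mean (π x) := by
  have h1 := π.toRealCLM.intervalIntegral_comp_comm
    ((α.continuous' x).intervalIntegrable (μ := MeasureTheory.volume) 0 1)
  refine h1.symm.trans ?_
  simp only [NonUnitalStarAlgHom.toRealCLM_apply, hπ]
  rfl

theorem mean_of_fixed {x : A} (hx : ∀ t, α t x = x) : α.mean x = x := by
  simp [mean, hx]

theorem isSelfAdjoint_mean {x : A} (hx : IsSelfAdjoint x) : IsSelfAdjoint (α.mean x) := by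
  have h1 := (starL' ℝ : A ≃L[ℝ] A).toContinuousLinearMap.intervalIntegral_comp_comm
    ((α.continuous' x).intervalIntegrable (μ := MeasureTheory.volume) 0 1)
  refine h1.symm.trans ?_
  refine intervalIntegral.integral_congr fun t _ => ?_
  show star (α t x) = α t x
  rw [← map_star, hx.star_eq]

end Generator

/-! ### Stability of the domain under inverses and square roots. -/

section Unital

variable {U : Type*} [CStarAlgebra U] (β : CStarFlow U)

theorem apply_one (t : ℝ) : β t 1 = 1 := by
  have h : β t (1 * β (-t) 1) = β t 1 := by
    rw [map_mul, ← β.map_add', add_neg_cancel, β.map_zero', mul_one]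
  rw [← h, one_mul, ← β.map_add', add_neg_cancel, β.map_zero']

theorem one_mem_domain : (1 : U) ∈ β.domain :=
  mem_domain_of_hasDerivAt (y := 0) (by
    simpa only [apply_one] using hasDerivAt_const (0 : ℝ) (1 : U))

theorem generator_one : β.generator 1 = 0 := β.generator_eq_zero_of_fixed β.apply_one

theorem hasDerivAt_mul {x y : U} (hx : x ∈ β.domain) (hy : y ∈ β.domain) :
    HasDerivAt (fun t : ℝ => β t (x * y)) (β.generator x * y + x * β.generator y) 0 := by
  simpa only [map_mul, β.map_zero'] using (hasDerivAt_zero hx).fun_mul (hasDerivAt_zero hy)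

theorem mul_mem_domain {x y : U} (hx : x ∈ β.domain) (hy : y ∈ β.domain) : x * y ∈ β.domain :=
  mem_domain_of_hasDerivAt (β.hasDerivAt_mul hx hy)

theorem generator_mul {x y : U} (hx : x ∈ β.domain) (hy : y ∈ β.domain) :
    β.generator (x * y) = β.generator x * y + x * β.generator y :=
  generator_eq (β.hasDerivAt_mul hx hy)

theorem inverse_mem_domain {x y : U} (hxy : x * y = 1) (hyx : y * x = 1) (hx : x ∈ β.domain) :
    y ∈ β.domain := by
  have hu : ∀ t, β t y = Ring.inverse (β t x) := fun t =>
    (Ring.inverse_unit ⟨β t x, β t y, by rw [← map_mul, hxy, apply_one],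
      by rw [← map_mul, hyx, apply_one]⟩).symm
  show DifferentiableAt ℝ (fun t : ℝ => β t y) 0
  simp only [hu]
  refine DifferentiableAt.comp (0 : ℝ) (differentiableAt_inverse ?_) hx
  rw [β.map_zero']
  exact ⟨⟨x, y, hxy, hyx⟩, rfl⟩

theorem isUnit_smul_clm {E : Type*} [NormedAddCommGroup E] [NormedSpace ℝ E] {c : ℝ}
    (hc : c ≠ 0) {T : E →L[ℝ] E} (hT : IsUnit T) : IsUnit (c • T) := by
  rw [Algebra.smul_def]
  exact ((IsUnit.mk0 _ hc).map (algebraMap ℝ (E →L[ℝ] E))).mul hT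

/-- The square root of an element of the domain is in the domain. Positivity and invertibility of the
square root `y` are expressed by the bound on `‖c - y‖`. -/
theorem mem_domain_of_mul_self {y : U} {c : ℝ} (hc : ‖(c : ℝ) • (1 : U) - y‖ < c)
    (hy : y * y ∈ β.domain) : y ∈ β.domain := by
  let M := ContinuousLinearMap.mul ℝ U
  -- `T t` is the Sylvester operator `z ↦ β_t(y) z + z y`. It sends `β_t(y) - y` to `β_t(y²) - y²`,
  -- so inverting it recovers the difference quotient of `y` from that of `y²`.
  let T : ℝ → (U →L[ℝ] U) := fun t => M (β t y) + M.flip y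
  have hT : Continuous T := (M.continuous.comp (β.continuous' y)).add continuous_const
  have hc0 : 0 < c := (norm_nonneg _).trans_lt hc
  -- With `d = c - y`, `T 0` is `2c` times the identity minus left and right multiplication by `d`,
  -- each of norm below `c`, so a Neumann series applies.
  have hT0 : IsUnit (T 0) := by
    let d := c • (1 : U) - y
    let R : U →L[ℝ] U := (2 * c)⁻¹ • (M d + M.flip d)
    have hM1 : ‖M d‖ ≤ ‖d‖ := ContinuousLinearMap.opNorm_mul_apply_le _ _ _
    have hM2 : ‖M.flip d‖ ≤ ‖d‖ := by
      refine ContinuousLinearMap.opNorm_le_bound _ (norm_nonneg _) fun z => ?_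
      rw [mul_comm]
      exact norm_mul_le z d
    have hR : ‖R‖ < 1 := by
      rw [norm_smul, Real.norm_of_nonneg (by positivity), inv_mul_lt_iff₀ (by positivity)]
      calc ‖M d + M.flip d‖ ≤ ‖d‖ + ‖d‖ := (norm_add_le _ _).trans (add_le_add hM1 hM2)
        _ < 2 * c * 1 := by
          have : ‖d‖ < c := hc
          linarith
    have h2 : (2 * c) ≠ 0 := by positivity
    have : T 0 = (2 * c) • (1 - R) := by
      rw [smul_sub, smul_inv_smul₀ h2]
      ext z
      simp only [T, M, d, β.map_zero', add_apply, sub_apply, smul_apply,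
        ContinuousLinearMap.mul_apply', ContinuousLinearMap.flip_apply, one_apply_eq_self,
        sub_mul, mul_sub, smul_mul_assoc, mul_smul_comm, one_mul, mul_one, two_mul, add_smul]
      abel
    rw [this]
    exact isUnit_smul_clm h2 (isUnit_one_sub_of_norm_lt_one hR)
  have hev : ∀ᶠ t in 𝓝[≠] (0 : ℝ), IsUnit (T t) :=
    (hT.continuousAt.eventually_mem (Units.isOpen.mem_nhds hT0)).filter_mono nhdsWithin_le_nhds
  have hw := hasDerivAt_iff_tendsto_slope_zero.1 (hasDerivAt_zero hy)
  have hinv : Tendsto (fun t => Ring.inverse (T t)) (𝓝[≠] 0) (𝓝 (Ring.inverse (T 0))) :=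
    ((NormedRing.inverse_continuousAt hT0.unit).tendsto.comp
      (hT.tendsto 0)).mono_left nhdsWithin_le_nhds
  refine mem_domain_of_hasDerivAt (hasDerivAt_iff_tendsto_slope_zero.2
    (((isBoundedBilinearMap_apply (𝕜 := ℝ)).continuous.tendsto (_, _)).comp
      (hinv.prodMk_nhds hw) |>.congr' ?_))
  filter_upwards [hev] with t ht
  have : t⁻¹ • (β (0 + t) (y * y) - β 0 (y * y)) = T t (t⁻¹ • (β (0 + t) y - β 0 y)) := by
    simp only [T, M, zero_add, β.map_zero', map_smul, map_mul, map_sub,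
      add_apply, ContinuousLinearMap.mul_apply',
      ContinuousLinearMap.flip_apply]
    congr 1
    abel
  show Ring.inverse (T t) (t⁻¹ • (β (0 + t) (y * y) - β 0 (y * y))) = _
  rw [this]
  exact DFunLike.congr_fun (Ring.inverse_mul_cancel _ ht) _

/-- The gap at `μ` bounds `|H - μ|` below, as the square root criterion requires, and its square `(H
- μ)²` is a polynomial in `H`. -/
theorem cfc_abs_sub_mem_domain {H : U} (hH : IsSelfAdjoint H) (hd : H ∈ β.domain) {μ : ℝ}
    (hμ : μ ∉ spectrum ℝ H) : cfc (fun s : ℝ => |s - μ|) H ∈ β.domain := by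
  obtain ⟨m, hm, hball⟩ := Metric.isOpen_iff.1
    (spectrum.isClosed (𝕜 := ℝ) H).isOpen_compl μ hμ
  obtain ⟨C, hC⟩ := (spectrum.isBounded (𝕜 := ℝ) H).subset_closedBall μ
  have hlow : ∀ s ∈ spectrum ℝ H, m ≤ |s - μ| := fun s hs => by
    by_contra! h
    exact hball (by simpa [Real.dist_eq] using h) hs
  have hup : ∀ s ∈ spectrum ℝ H, |s - μ| ≤ max C m := fun s hs =>
    le_max_of_le_left (by simpa [Real.dist_eq] using hC hs)
  refine β.mem_domain_of_mul_self (c := max C m) ?_ ?_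
  · have : (max C m) • (1 : U) - cfc (fun s : ℝ => |s - μ|) H
        = cfc (fun s : ℝ => max C m - |s - μ|) H := by
      rw [cfc_sub _ _ H, cfc_const _ H, Algebra.algebraMap_eq_smul_one]
    rw [this]
    have hM : m ≤ max C m := le_max_right _ _
    refine (norm_cfc_le (c := max C m - m) (by linarith) fun s hs => ?_).trans_lt (by linarith)
    have h1 := hlow s hs
    have h2 := hup s hs
    rw [Real.norm_of_nonneg (by linarith)]
    linarith
  · have : cfc (fun s : ℝ => |s - μ|) H * cfc (fun s : ℝ => |s - μ|) H
        = (H - (μ : ℂ) • (1 : U)) * (H - (μ : ℂ) • 1) := by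
      have h1 : H - (μ : ℂ) • (1 : U) = cfc (fun s : ℝ => s - μ) H := by
        rw [cfc_sub _ _ H, cfc_const _ H, cfc_id' ℝ H, Algebra.algebraMap_eq_smul_one,
          Complex.coe_smul]
      rw [h1, ← cfc_mul _ _ H, ← cfc_mul _ _ H]
      simp only [abs_mul_abs_self]
    rw [this, sub_eq_add_neg, ← neg_smul]
    have := mem_domain_of_hasDerivAt (β.hasDerivAt_add hd
      (mem_domain_of_hasDerivAt (β.hasDerivAt_smul (-(μ : ℂ)) β.one_mem_domain)))
    exact β.mul_mem_domain this this

end Unital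

end CStarFlow

/-! ### Spectral projections at gaps and perturbations that fix them. -/

namespace CStarFlow

section Unital

variable {U : Type*} [CStarAlgebra U] (β : CStarFlow U)

theorem add_mem_domain {x y : U} (hx : x ∈ β.domain) (hy : y ∈ β.domain) : x + y ∈ β.domain :=
  mem_domain_of_hasDerivAt (β.hasDerivAt_add hx hy)

theorem smul_mem_domain (c : ℂ) {x : U} (hx : x ∈ β.domain) : c • x ∈ β.domain :=
  mem_domain_of_hasDerivAt (β.hasDerivAt_smul c hx)

theorem sub_mem_domain {x y : U} (hx : x ∈ β.domain) (hy : y ∈ β.domain) : x - y ∈ β.domain := by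
  rw [sub_eq_add_neg, ← neg_one_smul ℂ y]
  exact β.add_mem_domain hx (β.smul_mem_domain _ hy)

/-- The projection is `(1 + sgn(H - μ)) / 2` with `sgn(H - μ) = (H - μ)|H - μ|⁻¹`, and the domain is
stable under inverses and products. -/
theorem cfc_indicator_Ioi_mem_domain {H : U} (hH : IsSelfAdjoint H) (hd : H ∈ β.domain) {μ : ℝ}
    (hμ : μ ∉ spectrum ℝ H) : cfc (fun s : ℝ => if μ < s then (1 : ℝ) else 0) H ∈ β.domain := by
  have hne : ∀ s ∈ spectrum ℝ H, |s - μ| ≠ 0 := fun s hs h => hμ (by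
    rw [abs_eq_zero, sub_eq_zero] at h
    rwa [← h])
  have hc : ContinuousOn (fun s : ℝ => |s - μ|) (spectrum ℝ H) := by fun_prop
  have hci : ContinuousOn (fun s : ℝ => |s - μ|⁻¹) (spectrum ℝ H) := hc.inv₀ hne
  have h1 : cfc (fun s : ℝ => |s - μ|⁻¹) H ∈ β.domain := by
    refine β.inverse_mem_domain ?_ ?_ (β.cfc_abs_sub_mem_domain hH hd hμ)
    · rw [← cfc_mul _ _ H hc hci, ← cfc_one ℝ H]
      exact cfc_congr fun s hs => mul_inv_cancel₀ (hne s hs)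
    · rw [← cfc_mul _ _ H hci hc, ← cfc_one ℝ H]
      exact cfc_congr fun s hs => inv_mul_cancel₀ (hne s hs)
  have h2 : H - (μ : ℂ) • (1 : U) = cfc (fun s : ℝ => s - μ) H := by
    rw [cfc_sub _ _ H, cfc_const _ H, cfc_id' ℝ H, Algebra.algebraMap_eq_smul_one,
      Complex.coe_smul]
  have h3 : cfc (fun s : ℝ => if μ < s then (1 : ℝ) else 0) H
      = (2⁻¹ : ℂ) • (1 + (H - (μ : ℂ) • (1 : U)) * cfc (fun s : ℝ => |s - μ|⁻¹) H) := by
    have h4 : (2⁻¹ : ℂ) = ((2⁻¹ : ℝ) : ℂ) := by norm_num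
    have hcs : ContinuousOn (fun s : ℝ => s - μ) (spectrum ℝ H) := by fun_prop
    have hcm : ContinuousOn (fun s : ℝ => (s - μ) * |s - μ|⁻¹) (spectrum ℝ H) := hcs.mul hci
    rw [h2, ← cfc_mul _ _ H hcs hci, ← cfc_const_one ℝ H,
      ← cfc_add H (fun _ => (1 : ℝ)) _ continuousOn_const hcm, h4, Complex.coe_smul,
      ← cfc_smul _ _ H (continuousOn_const.fun_add hcm)]
    refine cfc_congr fun s hs => ?_
    have h5 := hne s hs
    simp only [smul_eq_mul]
    split_ifs with h
    · rw [abs_of_pos (sub_pos.2 h)] at h5 ⊢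
      rw [mul_inv_cancel₀ h5]
      norm_num
    · rw [abs_of_nonpos (by linarith)] at h5 ⊢
      rw [inv_neg, mul_neg, mul_inv_cancel₀ (neg_ne_zero.1 h5)]
      norm_num
  rw [h3]
  exact β.smul_mem_domain _ (β.add_mem_domain β.one_mem_domain (β.mul_mem_domain
    (β.sub_mem_domain hd (β.smul_mem_domain _ β.one_mem_domain)) h1))

/-- For a finite partition of unity by projections in the domain, the generator is implemented on
them by the commutator with `∑ i, δ(p i) * p i`. -/
theorem generator_eq_commutator {ι : Type*} {s : Finset ι} {p : ι → U}
    (hp : ∀ i ∈ s, p i ∈ β.domain) (hid : ∀ i ∈ s, p i * p i = p i)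
    (horth : ∀ i ∈ s, ∀ j ∈ s, i ≠ j → p i * p j = 0) (hsum : ∑ i ∈ s, p i = 1) {j : ι}
    (hj : j ∈ s) :
    β.generator (p j) = (∑ i ∈ s, β.generator (p i) * p i) * p j
      - p j * ∑ i ∈ s, β.generator (p i) * p i := by
  have hdd : β.generator (p j) = β.generator (p j) * p j + p j * β.generator (p j) := by
    conv_lhs => rw [← hid j hj]
    exact β.generator_mul (hp j hj) (hp j hj)
  have h0 : p j * β.generator (p j) * p j = 0 := by
    have h := congrArg (fun x => p j * x * p j) hdd
    simp only [mul_add, add_mul] at h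
    rw [mul_assoc (p j) (_ * _), mul_assoc (β.generator (p j)), ← mul_assoc (p j) (p j),
      hid j hj, ← mul_assoc] at h
    simpa using h
  have h1 : (∑ i ∈ s, β.generator (p i) * p i) * p j = β.generator (p j) * p j := by
    rw [Finset.sum_mul, Finset.sum_eq_single_of_mem j hj fun i hi hij => by
      rw [mul_assoc, horth i hi j hj hij, mul_zero], mul_assoc, hid j hj]
  -- For `i ≠ j` differentiate `p_j p_i = 0`; for `i = j` both sides vanish by `p_j δ(p_j) p_j = 0`.
  -- The uniform right-hand side can be summed with `∑ p_i = 1`.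
  have h2 : ∀ i ∈ s, p j * (β.generator (p i) * p i)
      = β.generator (p j) * p j * p i - β.generator (p j) * p i := by
    intro i hi
    by_cases hij : j = i
    · subst hij
      rw [mul_assoc (β.generator _), hid j hj, sub_self, ← mul_assoc, h0]
    · have h3 : β.generator (p j) * p i + p j * β.generator (p i) = 0 := by
        rw [← β.generator_mul (hp j hj) (hp i hi), horth j hj i hi hij, generator_zero]
      rw [← mul_assoc, eq_neg_of_add_eq_zero_right h3, neg_mul, mul_assoc, hid i hi,
        mul_assoc (β.generator _), horth j hj i hi hij, mul_zero, zero_sub]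
  rw [h1, Finset.mul_sum, Finset.sum_congr rfl h2, Finset.sum_sub_distrib, ← Finset.mul_sum,
    ← Finset.mul_sum, hsum, mul_one, mul_one]
  abel

/-- Each term plus its adjoint is `δ(p_i²) = δ(p_i)`, and these add up to `δ(1) = 0`. -/
theorem star_sum_generator_mul {ι : Type*} {s : Finset ι} {p : ι → U}
    (hp : ∀ i ∈ s, p i ∈ β.domain) (hid : ∀ i ∈ s, p i * p i = p i)
    (hsa : ∀ i ∈ s, IsSelfAdjoint (p i)) (hsum : ∑ i ∈ s, p i = 1) :
    star (∑ i ∈ s, β.generator (p i) * p i) = -∑ i ∈ s, β.generator (p i) * p i := by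
  rw [eq_neg_iff_add_eq_zero, star_sum, ← Finset.sum_add_distrib]
  have h1 : ∀ i ∈ s, star (β.generator (p i) * p i) + β.generator (p i) * p i
      = β.generator (p i) := by
    intro i hi
    have hs : star (β.generator (p i)) = β.generator (p i) := by
      rw [← generator_eq (β.hasDerivAt_star (hp i hi)), (hsa i hi).star_eq]
    rw [star_mul, hs, (hsa i hi).star_eq, add_comm, ← β.generator_mul (hp i hi) (hp i hi),
      hid i hi]
  rw [Finset.sum_congr rfl h1, ← generator_eq (β.hasDerivAt_sum s hp), hsum, generator_one]

/-- The spectral projection of `H` for the set of reals whose multiple by `η⁻¹` rounds to `j`. -/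
noncomputable def stepProj (η : ℝ) (H : U) (j : ℤ) : U :=
  cfc (fun s : ℝ => if round (s / η) = j then (1 : ℝ) else 0) H

/-- The spectrum rounded to multiples of `η`. -/
noncomputable def roundOff (η : ℝ) (H : U) : U := cfc (fun s : ℝ => η * (round (s / η) : ℝ)) H

/-- A perturbation of the flow that fixes the spectral projections `stepProj η H j`. -/
noncomputable def stepPerturb (η : ℝ) (H : U) (N : ℕ) : U :=
  Complex.I • ∑ j ∈ Finset.Icc (-N : ℤ) N, β.generator (stepProj η H j) * stepProj η H j

theorem round_div_eq_iff {η : ℝ} (hη : 0 < η) {s : ℝ} {j : ℤ} :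
    round (s / η) = j ↔ η * (((j - 1 : ℤ) : ℝ) + 1 / 2) ≤ s ∧ s < η * ((j : ℝ) + 1 / 2) := by
  rw [round_eq, Int.floor_eq_iff, ← sub_le_iff_le_add, le_div_iff₀' hη, ← lt_sub_iff_add_lt,
    div_lt_iff₀' hη]
  push_cast
  ring_nf

/-! ### Rounding off a spectrum that avoids the midpoints. -/

section Spectrum

variable {η : ℝ} {H : U}

theorem continuousOn_round (hη : 0 < η)
    (hμ : ∀ j : ℤ, η * ((j : ℝ) + 1 / 2) ∉ spectrum ℝ H) :
    ContinuousOn (fun s : ℝ => round (s / η)) (spectrum ℝ H) := by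
  intro s hs
  refine ContinuousAt.continuousWithinAt ?_
  obtain ⟨h1, h2⟩ := (round_div_eq_iff hη).1 (rfl : round (s / η) = round (s / η))
  have h1' := lt_of_le_of_ne h1 fun h => hμ _ (h ▸ hs)
  refine continuousAt_const.congr (f := fun _ => round (s / η)) ?_
  filter_upwards [Ioo_mem_nhds h1' h2] with u hu
  exact ((round_div_eq_iff hη).2 ⟨hu.1.le, hu.2⟩).symm

/-- Rounding jumps only at midpoints, which the spectrum avoids, so it is continuous there into the
discrete space `ℤ`. -/
theorem continuousOn_step (hη : 0 < η)
    (hμ : ∀ j : ℤ, η * ((j : ℝ) + 1 / 2) ∉ spectrum ℝ H) (f : ℤ → ℝ) :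
    ContinuousOn (fun s : ℝ => f (round (s / η))) (spectrum ℝ H) :=
  continuous_of_discreteTopology.comp_continuousOn (continuousOn_round hη hμ)

theorem stepProj_mem_domain (hη : 0 < η) (hH : IsSelfAdjoint H) (hd : H ∈ β.domain)
    (hμ : ∀ j : ℤ, η * ((j : ℝ) + 1 / 2) ∉ spectrum ℝ H) (j : ℤ) :
    stepProj η H j ∈ β.domain := by
  have hc : ∀ i : ℤ, ContinuousOn
      (fun s : ℝ => if η * ((i : ℝ) + 1 / 2) < s then (1 : ℝ) else 0) (spectrum ℝ H) := by
    intro i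
    refine (continuousOn_step hη hμ fun j => if i < j then (1 : ℝ) else 0).congr fun s hs => ?_
    obtain ⟨h1, h2⟩ := (round_div_eq_iff hη).1 (rfl : round (s / η) = round (s / η))
    by_cases h : i < round (s / η)
    · have h3 : (i : ℝ) ≤ ((round (s / η) - 1 : ℤ) : ℝ) := by
        exact_mod_cast Int.le_sub_one_of_lt h
      have h4 : η * ((i : ℝ) + 1 / 2) ≤ s := (by gcongr : η * ((i : ℝ) + 1 / 2) ≤ _).trans h1
      have h5 := lt_of_le_of_ne h4 fun h => hμ _ (h ▸ hs)
      simp only [if_pos h, if_pos h5]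
    · have h3 : (round (s / η) : ℝ) ≤ i := by exact_mod_cast not_lt.1 h
      have h4 : s < η * ((i : ℝ) + 1 / 2) := h2.trans_le (by gcongr)
      simp only [if_neg h, if_neg h4.not_gt]
  -- The band around `η j` is the difference of the half-lines beyond its two midpoints; endpoints
  -- are immaterial since both lie outside the spectrum.
  have : stepProj η H j
      = cfc (fun s : ℝ => if η * (((j - 1 : ℤ) : ℝ) + 1 / 2) < s then (1 : ℝ) else 0) H
        - cfc (fun s : ℝ => if η * ((j : ℝ) + 1 / 2) < s then (1 : ℝ) else 0) H := by
    rw [← cfc_sub _ _ H (hc _) (hc _)]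
    refine cfc_congr fun s hs => ?_
    have h0 : η * (((j - 1 : ℤ) : ℝ) + 1 / 2) < η * ((j : ℝ) + 1 / 2) := by
      push_cast
      gcongr
      linarith
    have h1 : s ≠ η * ((j : ℝ) + 1 / 2) := fun h => hμ _ (h ▸ hs)
    have h2 : s ≠ η * (((j - 1 : ℤ) : ℝ) + 1 / 2) := fun h => hμ _ (h ▸ hs)
    simp only [round_div_eq_iff hη]
    rcases lt_or_gt_of_ne h2 with h3 | h3
    · rw [if_neg fun h => h.1.not_gt h3, if_neg h3.not_gt, if_neg (h3.trans h0).not_gt, sub_zero]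
    · rcases lt_or_gt_of_ne h1 with h4 | h4
      · rw [if_pos ⟨h3.le, h4⟩, if_pos h3, if_neg h4.not_gt, sub_zero]
      · rw [if_neg fun h => h.2.not_gt h4, if_pos h3, if_pos h4, sub_self]
  rw [this]
  exact β.sub_mem_domain (β.cfc_indicator_Ioi_mem_domain hH hd (hμ _))
    (β.cfc_indicator_Ioi_mem_domain hH hd (hμ _))

theorem stepProj_mul_stepProj (hη : 0 < η)
    (hμ : ∀ j : ℤ, η * ((j : ℝ) + 1 / 2) ∉ spectrum ℝ H) (i j : ℤ) :
    stepProj η H i * stepProj η H j = if i = j then stepProj η H i else 0 := by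
  have hc := fun i => continuousOn_step hη hμ fun j => if j = i then (1 : ℝ) else 0
  rw [stepProj, stepProj, ← cfc_mul _ _ H (hc i) (hc j)]
  split_ifs with h
  · subst h
    exact cfc_congr fun s _ => by simp
  · rw [← cfc_zero ℝ H]
    refine cfc_congr fun s _ => ?_
    by_cases h1 : round (s / η) = i
    · have h2 : round (s / η) ≠ j := fun h2 => h (h1.symm.trans h2)
      simp [h2]
    · simp [h1]

theorem isSelfAdjoint_stepProj (j : ℤ) : IsSelfAdjoint (stepProj η H j) :=
  cfc_predicate (p := IsSelfAdjoint) _ H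

theorem isSelfAdjoint_roundOff : IsSelfAdjoint (roundOff η H) :=
  cfc_predicate (p := IsSelfAdjoint) _ H

theorem sum_smul_stepProj (hη : 0 < η)
    (hμ : ∀ j : ℤ, η * ((j : ℝ) + 1 / 2) ∉ spectrum ℝ H) {N : ℕ}
    (hN : ∀ s ∈ spectrum ℝ H, round (s / η) ∈ Finset.Icc (-N : ℤ) N) (c : ℤ → ℝ) :
    ∑ j ∈ Finset.Icc (-N : ℤ) N, (c j : ℂ) • stepProj η H j
      = cfc (fun s : ℝ => c (round (s / η))) H := by
  have hc := fun i => continuousOn_step hη hμ fun j => if j = i then (1 : ℝ) else 0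
  have h1 : ∀ j, (c j : ℂ) • stepProj η H j
      = cfc (fun s : ℝ => c j • if round (s / η) = j then (1 : ℝ) else 0) H := fun j => by
    rw [Complex.coe_smul, stepProj, ← cfc_smul _ _ H (hc j)]
  simp only [h1]
  rw [← cfc_sum (fun j (s : ℝ) => c j • if round (s / η) = j then (1 : ℝ) else 0) H _
    fun i _ => (hc i).const_smul (c i)]
  refine cfc_congr fun s hs => ?_
  have := hN s hs
  simp only [Finset.sum_apply, smul_eq_mul, mul_ite, mul_one, mul_zero]
  rw [Finset.sum_ite_eq, if_pos this]

theorem sum_stepProj (hη : 0 < η) (hH : IsSelfAdjoint H)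
    (hμ : ∀ j : ℤ, η * ((j : ℝ) + 1 / 2) ∉ spectrum ℝ H) {N : ℕ}
    (hN : ∀ s ∈ spectrum ℝ H, round (s / η) ∈ Finset.Icc (-N : ℤ) N) :
    ∑ j ∈ Finset.Icc (-N : ℤ) N, stepProj η H j = 1 := by
  have := sum_smul_stepProj hη hμ hN fun _ => 1
  simpa [cfc_const_one ℝ H] using this

theorem exists_round_mem_Icc (η : ℝ) (H : U) :
    ∃ N : ℕ, ∀ s ∈ spectrum ℝ H, round (s / η) ∈ Finset.Icc (-N : ℤ) N := by
  obtain ⟨C, hC⟩ := (spectrum.isBounded (𝕜 := ℝ) H).subset_closedBall 0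
  obtain ⟨N, hN⟩ := exists_nat_ge (C / |η| + 1)
  refine ⟨N, fun s hs => ?_⟩
  have h1 : |s| ≤ C := by simpa using hC hs
  have h2 : |s / η| ≤ C / |η| := by rw [abs_div]; gcongr
  have h3 := abs_le.1 ((abs_sub_round (s / η)))
  have h4 := abs_le.1 h2
  rw [Finset.mem_Icc]
  constructor
  · have : ((-N : ℤ) : ℝ) ≤ (round (s / η) : ℝ) := by push_cast; linarith
    exact_mod_cast this
  · have : (round (s / η) : ℝ) ≤ ((N : ℤ) : ℝ) := by push_cast; linarith
    exact_mod_cast this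

theorem norm_sub_roundOff_le (hη : 0 < η) (hH : IsSelfAdjoint H)
    (hμ : ∀ j : ℤ, η * ((j : ℝ) + 1 / 2) ∉ spectrum ℝ H) : ‖H - roundOff η H‖ ≤ η / 2 := by
  have : H - roundOff η H = cfc (fun s : ℝ => s - η * (round (s / η) : ℝ)) H := by
    rw [cfc_sub _ _ H (by fun_prop) (continuousOn_step hη hμ fun j => η * (j : ℝ)), cfc_id' ℝ H]
    rfl
  rw [this]
  refine norm_cfc_le (by positivity) fun s _ => ?_
  have h1 : s - η * (round (s / η) : ℝ) = η * (s / η - round (s / η)) := by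
    rw [mul_sub, mul_div_cancel₀ _ hη.ne']
  rw [h1, norm_mul, Real.norm_of_nonneg hη.le, Real.norm_eq_abs]
  have := abs_sub_round (s / η)
  nlinarith

theorem finite_spectrum_roundOff (hη : 0 < η) (hH : IsSelfAdjoint H)
    (hμ : ∀ j : ℤ, η * ((j : ℝ) + 1 / 2) ∉ spectrum ℝ H) :
    (spectrum ℂ (roundOff η H)).Finite := by
  obtain ⟨N, hN⟩ := exists_round_mem_Icc η H
  rw [← (isSelfAdjoint_roundOff (η := η) (H := H)).spectrumRestricts.algebraMap_image]
  refine Set.Finite.image _ ?_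
  rw [roundOff, cfc_map_spectrum _ H hH (continuousOn_step hη hμ fun j => η * (j : ℝ))]
  refine ((Finset.Icc (-N : ℤ) N).finite_toSet.image fun j : ℤ => η * (j : ℝ)).subset ?_
  rintro _ ⟨s, hs, rfl⟩
  exact ⟨_, hN s hs, rfl⟩

theorem roundOff_mem_domain (hη : 0 < η) (hH : IsSelfAdjoint H) (hd : H ∈ β.domain)
    (hμ : ∀ j : ℤ, η * ((j : ℝ) + 1 / 2) ∉ spectrum ℝ H) : roundOff η H ∈ β.domain := by
  obtain ⟨N, hN⟩ := exists_round_mem_Icc η H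
  rw [roundOff, ← sum_smul_stepProj hη hμ hN fun j => η * (j : ℝ)]
  exact mem_domain_of_hasDerivAt (β.hasDerivAt_sum _ fun j _ =>
    β.smul_mem_domain _ (β.stepProj_mem_domain hη hH hd hμ j))

/-- The commutator formula for the projections extends linearly to `∑ η j p_j`. Writing the
perturbation as `b = i d` gives `i[b, k] = -[d, k] = -δ(k)`. -/
theorem generator_roundOff_add (hη : 0 < η) (hH : IsSelfAdjoint H) (hd : H ∈ β.domain)
    (hμ : ∀ j : ℤ, η * ((j : ℝ) + 1 / 2) ∉ spectrum ℝ H) {N : ℕ}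
    (hN : ∀ s ∈ spectrum ℝ H, round (s / η) ∈ Finset.Icc (-N : ℤ) N) :
    β.generator (roundOff η H) + Complex.I •
      (β.stepPerturb η H N * roundOff η H - roundOff η H * β.stepPerturb η H N) = 0 := by
  have hp := fun j => β.stepProj_mem_domain hη hH hd hμ j
  have hg : β.generator (roundOff η H) =
      (∑ i ∈ Finset.Icc (-N : ℤ) N, β.generator (stepProj η H i) * stepProj η H i) * roundOff η H
      - roundOff η H *
        ∑ i ∈ Finset.Icc (-N : ℤ) N, β.generator (stepProj η H i) * stepProj η H i := by
    rw [roundOff, ← sum_smul_stepProj hη hμ hN fun j => η * (j : ℝ),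
      generator_eq (β.hasDerivAt_sum _ fun j _ => β.smul_mem_domain _ (hp j)),
      Finset.mul_sum, Finset.sum_mul, ← Finset.sum_sub_distrib]
    refine Finset.sum_congr rfl fun j hj => ?_
    rw [generator_eq (β.hasDerivAt_smul _ (hp j)), mul_smul_comm, smul_mul_assoc, ← smul_sub]
    congr 1
    refine β.generator_eq_commutator (fun i _ => hp i) (fun i _ => ?_) (fun i _ j _ hij => ?_)
      (sum_stepProj hη hH hμ hN) hj
    · rw [stepProj_mul_stepProj hη hμ, if_pos rfl]
    · rw [stepProj_mul_stepProj hη hμ, if_neg hij]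
  rw [stepPerturb, smul_mul_assoc, mul_smul_comm, ← smul_sub, smul_smul, Complex.I_mul_I, hg,
    neg_one_smul, add_neg_cancel]

theorem isSelfAdjoint_stepPerturb (hη : 0 < η) (hH : IsSelfAdjoint H) (hd : H ∈ β.domain)
    (hμ : ∀ j : ℤ, η * ((j : ℝ) + 1 / 2) ∉ spectrum ℝ H) {N : ℕ}
    (hN : ∀ s ∈ spectrum ℝ H, round (s / η) ∈ Finset.Icc (-N : ℤ) N) :
    IsSelfAdjoint (β.stepPerturb η H N) := by
  rw [IsSelfAdjoint, stepPerturb, star_smul, β.star_sum_generator_mul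
    (fun j _ => β.stepProj_mem_domain hη hH hd hμ j)
    (fun i _ => by rw [stepProj_mul_stepProj hη hμ, if_pos rfl])
    (fun i _ => isSelfAdjoint_stepProj i) (sum_stepProj hη hH hμ hN)]
  simp

theorem map_stepPerturb_eq_zero {V : Type*} [CStarAlgebra V] {γ : CStarFlow V}
    (hη : 0 < η) (hH : IsSelfAdjoint H) (hd : H ∈ β.domain)
    (hμ : ∀ j : ℤ, η * ((j : ℝ) + 1 / 2) ∉ spectrum ℝ H) (π : U →⋆ₐ[ℂ] V)
    (hπ : ∀ t x, π (β t x) = γ t (π x)) (hfix : ∀ t, γ t (π H) = π H) (N : ℕ) :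
    π (β.stepPerturb η H N) = 0 := by
  have h1 : ∀ j t, γ t (π (stepProj η H j)) = π (stepProj η H j) := by
    intro j t
    -- `φ = γ_t ∘ π` and `π` are ⋆-homomorphisms agreeing at `H`, hence at its functional calculus.
    -- So `π(p_j)` is fixed, and `π(δ(p_j)) = δ(π(p_j)) = 0`.
    let φ : U →⋆ₐ[ℂ] V := { (π : U →ₐ[ℂ] V) with
      toFun := fun x => γ t (π x)
      map_one' := by rw [map_one, apply_one]
      map_zero' := by rw [map_zero, map_zero]
      map_add' := fun x y => by rw [map_add, map_add]
      map_mul' := fun x y => by rw [map_mul, map_mul]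
      map_star' := fun x => by rw [map_star, map_star]
      commutes' := fun c => by
        rw [Algebra.algebraMap_eq_smul_one, map_smul, map_one, map_smul, apply_one,
          Algebra.algebraMap_eq_smul_one] }
    have hcont : ∀ ψ : U →⋆ₐ[ℂ] V, Continuous ψ := fun ψ =>
      NonUnitalStarAlgHom.continuous_of_cstar ψ.toNonUnitalStarAlgHom
    have hc := continuousOn_step hη hμ fun i => if i = j then (1 : ℝ) else 0
    have e1 : π (stepProj η H j) = _ := π.map_cfc _ H hc (hcont π) hH (hH.map π)
    have e2 : φ (stepProj η H j) = _ := φ.map_cfc _ H hc (hcont φ) hH (hH.map φ)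
    have e3 : φ H = π H := hfix t
    rw [e3, ← e1] at e2
    exact e2
  rw [stepPerturb, map_smul, map_sum, Finset.sum_eq_zero, smul_zero]
  intro j _
  have h2 := β.hasDerivAt_map (β := γ) π.toNonUnitalStarAlgHom hπ
    (β.stepProj_mem_domain hη hH hd hμ j)
  have h3 : π (β.generator (stepProj η H j)) = 0 :=
    (generator_eq h2).symm.trans (γ.generator_eq_zero_of_fixed (h1 j))
  rw [map_mul, h3, zero_mul]

end Spectrum

end Unital

end CStarFlow

/-! ### Scalar and algebra parts in the unitization. -/

namespace Unitization

variable {A B : Type*} [NonUnitalCStarAlgebra A] [NonUnitalCStarAlgebra B]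

theorem fst_starMap (π : A →⋆ₙₐ[ℂ] B) (z : Unitization ℂ A) :
    (starMap π z).fst = z.fst := by
  simp [starMap_apply, algebraMap_eq_inl]

theorem snd_starMap (π : A →⋆ₙₐ[ℂ] B) (z : Unitization ℂ A) :
    (starMap π z).snd = π z.snd := by
  simp [starMap_apply, algebraMap_eq_inl]

theorem isSelfAdjoint_iff_fst_snd {z : Unitization ℂ A} :
    IsSelfAdjoint z ↔ IsSelfAdjoint z.fst ∧ IsSelfAdjoint z.snd := by
  simp [IsSelfAdjoint, Unitization.ext_iff]

/-- The projection onto the scalars as a ⋆-homomorphism. -/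
def fstStarHom (A : Type*) [NonUnitalCStarAlgebra A] : Unitization ℂ A →⋆ₐ[ℂ] ℂ :=
  { fstHom ℂ A with map_star' := fun _ => rfl }

/-- The scalar part is a character, and characters commute with the functional calculus. This
controls when a function of `z` stays in the non-unital algebra. -/
theorem fst_cfc {z : Unitization ℂ A} (hz : IsSelfAdjoint z) {r : ℝ} (hr : z.fst = r)
    {f : ℝ → ℝ} (hf : ContinuousOn f (spectrum ℝ z)) : (cfc f z).fst = f r := by
  have h := (fstStarHom A).map_cfc f z hf
    (NonUnitalStarAlgHom.continuous_of_cstar (fstStarHom A).toNonUnitalStarAlgHom) hz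
    (hz.map (fstStarHom A))
  refine h.trans ?_
  have h2 : fstStarHom A z = algebraMap ℝ ℂ r := hr
  rw [h2, cfc_algebraMap]
  rfl

theorem norm_snd_le (z : Unitization ℂ A) : ‖z.snd‖ ≤ ‖z‖ + ‖z.fst‖ := by
  have h : ((z.snd : A) : Unitization ℂ A) = z - algebraMap ℂ (Unitization ℂ A) z.fst := by
    refine eq_sub_of_add_eq (Unitization.ext ?_ ?_) <;> simp [algebraMap_eq_inl]
  rw [← norm_inr (𝕜 := ℂ), h]
  exact (norm_sub_le _ _).trans (by rw [norm_algebraMap'])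

theorem norm_le_norm_fst_add (z : Unitization ℂ A) : ‖z‖ ≤ ‖z.fst‖ + ‖z.snd‖ := by
  have h : z = algebraMap ℂ (Unitization ℂ A) z.fst + ((z.snd : A) : Unitization ℂ A) := by
    refine Unitization.ext ?_ ?_ <;> simp [algebraMap_eq_inl]
  conv_lhs => rw [h]
  exact (norm_add_le _ _).trans (by rw [norm_algebraMap', norm_inr])

end Unitization

namespace CStarFlow

variable {A : Type*} [NonUnitalCStarAlgebra A] (α : CStarFlow A)

/-! ### The flow on the unitization. -/

section Unitize

/-- The extension of a flow to the unitization. -/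
noncomputable def unitize : CStarFlow (Unitization ℂ A) where
  toFun t := (Unitization.starMap (α t)).toNonUnitalStarAlgHom
  map_zero' z := by
    refine Unitization.ext (Unitization.fst_starMap _ _) ?_
    exact (Unitization.snd_starMap _ _).trans (α.map_zero' _)
  map_add' s t z := by
    refine Unitization.ext ?_ ?_
    · show (Unitization.starMap (α (s + t)) z).fst
        = (Unitization.starMap (α s) (Unitization.starMap (α t) z)).fst
      simp only [Unitization.fst_starMap]
    · show (Unitization.starMap (α (s + t)) z).snd
        = (Unitization.starMap (α s) (Unitization.starMap (α t) z)).snd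
      simp only [Unitization.snd_starMap, α.map_add']
  continuous' z := by
    have h := (Unitization.inrNonUnitalStarAlgHom ℂ A).continuous_of_cstar.comp
      (α.continuous' z.snd)
    exact continuous_const.add h

theorem fst_unitize (t : ℝ) (z : Unitization ℂ A) : (α.unitize t z).fst = z.fst :=
  Unitization.fst_starMap _ _

theorem snd_unitize (t : ℝ) (z : Unitization ℂ A) : (α.unitize t z).snd = α t z.snd :=
  Unitization.snd_starMap _ _

theorem starMap_unitize {B : Type*} [NonUnitalCStarAlgebra B] {β : CStarFlow B}
    {π : A →⋆ₙₐ[ℂ] B} (hπ : ∀ t x, π (α t x) = β t (π x)) (t : ℝ) (z : Unitization ℂ A) :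
    Unitization.starMap π (α.unitize t z) = β.unitize t (Unitization.starMap π z) := by
  refine Unitization.ext ?_ ?_ <;> simp only [fst_unitize, snd_unitize, Unitization.fst_starMap,
    Unitization.snd_starMap, hπ]

theorem hasDerivAt_unitize {z : Unitization ℂ A} (hz : z.snd ∈ α.domain) :
    HasDerivAt (fun t : ℝ => α.unitize t z) (α.generator z.snd : Unitization ℂ A) 0 := by
  have h := (Unitization.inrNonUnitalStarAlgHom ℂ A).toRealCLM.hasFDerivAt.comp_hasDerivAt
    (0 : ℝ) (hasDerivAt_zero hz)
  exact h.const_add (algebraMap ℂ (Unitization ℂ A) z.fst)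

/-- The projection of the unitization onto the algebra as a continuous real linear map. -/
noncomputable def sndRealCLM (A : Type*) [NonUnitalCStarAlgebra A] : Unitization ℂ A →L[ℝ] A where
  toFun z := z.snd
  map_add' _ _ := rfl
  map_smul' _ _ := rfl
  cont := Unitization.continuous_snd

theorem mem_domain_unitize_iff {z : Unitization ℂ A} :
    z ∈ α.unitize.domain ↔ z.snd ∈ α.domain := by
  refine ⟨fun hz => ?_, fun hz => mem_domain_of_hasDerivAt (α.hasDerivAt_unitize hz)⟩
  have h := (sndRealCLM A).hasFDerivAt.comp_hasDerivAt (0 : ℝ) (hasDerivAt_zero hz)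
  refine mem_domain_of_hasDerivAt (y := (α.unitize.generator z).snd)
    (h.congr_of_eventuallyEq (Eventually.of_forall fun t => ?_))
  exact (α.snd_unitize t z).symm

theorem generator_unitize {z : Unitization ℂ A} (hz : z.snd ∈ α.domain) :
    α.unitize.generator z = (α.generator z.snd : Unitization ℂ A) :=
  generator_eq (α.hasDerivAt_unitize hz)

end Unitize

/-! ### Equivariant maps on `ℓ^∞_α` and lifts of fixed points. -/

section SeqHoms

/-- The quotient map `ℓ^∞_α → A^∞_α` as a ⋆-homomorphism. -/
noncomputable def mkHom : α.contSeq →⋆ₙₐ[ℂ] α.AsympAlg where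
  toFun := AsympAlg.mk
  map_smul' c x := map_smul AsympAlg.mk c x
  map_zero' := map_zero AsympAlg.mk
  map_add' x y := map_add AsympAlg.mk x y
  map_mul' x y := AsympAlg.mk_mul α x y
  map_star' x := AsympAlg.mk_star α x

theorem mkHom_flow (t : ℝ) (x : α.contSeq) :
    α.mkHom (α.contSeqFlow t x) = α.asympFlow t (α.mkHom x) := (α.asympFlow_mk t x).symm

/-- The evaluation of sequences at `n`. -/
noncomputable def evalHom (n : ℕ) : α.contSeq →⋆ₙₐ[ℂ] A where
  toFun x := (x : BddSeq A) n
  map_smul' _ _ := rfl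
  map_zero' := rfl
  map_add' _ _ := rfl
  map_mul' _ _ := rfl
  map_star' _ := rfl

theorem evalHom_flow (n : ℕ) (t : ℝ) (x : α.contSeq) :
    α.evalHom n (α.contSeqFlow t x) = α t (α.evalHom n x) := rfl

/-- Replacing the first `N` entries of a bounded sequence by zero. -/
noncomputable def truncBdd (A : Type*) [NonUnitalCStarAlgebra A] (N : ℕ) :
    BddSeq A →⋆ₙₐ[ℂ] BddSeq A where
  toFun x := ⟨fun n => if n < N then 0 else x n, memℓp_infty (by
    refine ⟨‖x‖, ?_⟩
    rintro _ ⟨n, rfl⟩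
    dsimp only
    split_ifs
    · simp
    · exact lp.norm_apply_le_norm ENNReal.top_ne_zero x n)⟩
  map_smul' c x := by
    ext n
    show (if n < N then (0 : A) else c • x n) = c • if n < N then (0 : A) else x n
    split_ifs <;> simp
  map_zero' := by
    ext n
    show (if n < N then (0 : A) else 0) = 0
    simp
  map_add' x y := by
    ext n
    show (if n < N then (0 : A) else x n + y n)
      = (if n < N then (0 : A) else x n) + if n < N then (0 : A) else y n
    split_ifs <;> simp
  map_mul' x y := by
    ext n
    show (if n < N then (0 : A) else x n * y n)
      = (if n < N then (0 : A) else x n) * if n < N then (0 : A) else y n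
    split_ifs <;> simp
  map_star' x := by
    ext n
    show (if n < N then (0 : A) else star (x n)) = star (if n < N then (0 : A) else x n)
    split_ifs <;> simp

theorem truncBdd_apply (N : ℕ) (x : BddSeq A) (n : ℕ) :
    truncBdd A N x n = if n < N then 0 else x n := rfl

theorem seqMap_truncBdd (N : ℕ) (t : ℝ) (x : BddSeq A) :
    α.seqMap t (truncBdd A N x) = truncBdd A N (α.seqMap t x) := by
  ext n
  rw [seqMap_apply, truncBdd_apply, truncBdd_apply, seqMap_apply]
  split_ifs <;> simp

/-- Replacing the first `N` entries of a sequence in `ℓ^∞_α` by zero. -/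
noncomputable def trunc (N : ℕ) : α.contSeq →⋆ₙₐ[ℂ] α.contSeq where
  toFun x := ⟨truncBdd A N x, by
    rw [mem_contSeq]
    simp only [seqMap_truncBdd]
    exact (truncBdd A N).continuous_of_cstar.comp (α.mem_contSeq.1 x.2)⟩
  map_smul' c x := Subtype.ext (map_smul (truncBdd A N) c (x : BddSeq A))
  map_zero' := Subtype.ext (map_zero (truncBdd A N))
  map_add' x y := Subtype.ext (map_add (truncBdd A N) (x : BddSeq A) y)
  map_mul' x y := Subtype.ext (map_mul (truncBdd A N) (x : BddSeq A) y)
  map_star' x := Subtype.ext (map_star (truncBdd A N) (x : BddSeq A))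

theorem trunc_apply (N : ℕ) (x : α.contSeq) (n : ℕ) :
    (α.trunc N x : BddSeq A) n = if n < N then 0 else (x : BddSeq A) n := rfl

theorem trunc_flow (N : ℕ) (t : ℝ) (x : α.contSeq) :
    α.trunc N (α.contSeqFlow t x) = α.contSeqFlow t (α.trunc N x) :=
  Subtype.ext (α.seqMap_truncBdd N t x).symm

theorem mkHom_trunc (N : ℕ) (x : α.contSeq) : α.mkHom (α.trunc N x) = α.mkHom x := by
  refine (AsympAlg.mk_eq_mk α).2 (α.mem_nullSeq.2 (tendsto_const_nhds.congr' ?_))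
  filter_upwards [eventually_ge_atTop N] with n hn
  show (0 : A) = (α.trunc N x : BddSeq A) n - (x : BddSeq A) n
  rw [trunc_apply, if_neg hn.not_gt, sub_self]

theorem tendsto_of_mkHom_eq_zero {x : α.contSeq} (hx : α.mkHom x = 0) :
    Tendsto (fun n => (x : BddSeq A) n) atTop (𝓝 0) := by
  have := (AsympAlg.mk_eq_mk α (x := x) (y := 0)).1 (by rw [map_zero]; exact hx)
  rwa [sub_zero] at this

theorem eventually_norm_trunc_lt {x : α.contSeq} (hx : α.mkHom x = 0) {r : ℝ} (hr : 0 < r) :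
    ∀ᶠ N in atTop, ‖α.trunc N x‖ < r := by
  obtain ⟨N, hN⟩ := eventually_atTop.1
    (Metric.tendsto_nhds.1 (α.tendsto_of_mkHom_eq_zero hx) _ (half_pos hr))
  filter_upwards [eventually_ge_atTop N] with M hM
  refine (lp.norm_le_of_forall_le (half_pos hr).le fun n => ?_).trans_lt (half_lt_self hr)
  show ‖(α.trunc M x : BddSeq A) n‖ ≤ r / 2
  rw [trunc_apply]
  split_ifs with h
  · simpa using (half_pos hr).le
  · simpa using (hN n (hM.trans (not_lt.1 h))).le

theorem norm_mkHom_sub_le {x y : α.contSeq} {r : ℝ} (hr : 0 ≤ r)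
    (h : ∀ᶠ n in atTop, ‖(x : BddSeq A) n - (y : BddSeq A) n‖ ≤ r) :
    ‖α.mkHom x - α.mkHom y‖ ≤ r := by
  rw [← map_sub]
  exact AsympAlg.norm_mk_le_of_eventually α hr h

/-- A bounded sequence in the domain on which the generator tends to zero represents a fixed point
of the flow on `A^∞_α`. -/
theorem exists_contSeq_of_generator_tendsto {x : ℕ → A} (hx : ∀ n, x n ∈ α.domain) {C : ℝ}
    (hC : ∀ n, ‖x n‖ ≤ C) (hδ : Tendsto (fun n => α.generator (x n)) atTop (𝓝 0)) :
    ∃ X : α.contSeq, (∀ n, (X : BddSeq A) n = x n) ∧ α.mkHom X ∈ α.asympFlow.fixedPoints := by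
  let Y : BddSeq A := ⟨x, memℓp_infty ⟨C, by rintro _ ⟨n, rfl⟩; exact hC n⟩⟩
  obtain ⟨D, hD⟩ := hδ.norm.bddAbove_range
  have hD' : ∀ n, ‖α.generator (x n)‖ ≤ D := fun n => hD ⟨n, rfl⟩
  have hD0 : 0 ≤ D := (norm_nonneg _).trans (hD' 0)
  have hY : Y ∈ α.contSeq := by
    rw [mem_contSeq]
    -- A bound on the generators common to all `n` makes the orbit Lipschitz in sup norm.
    refine (LipschitzWith.of_dist_le_mul (K := ⟨D, hD0⟩) fun s t => ?_).continuous
    rw [dist_eq_norm]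
    refine lp.norm_le_of_forall_le (by positivity) fun n => ?_
    refine (α.norm_apply_sub_le (hx n) t s).trans ?_
    rw [← Real.dist_eq]
    exact mul_le_mul_of_nonneg_right (hD' n) dist_nonneg
  refine ⟨⟨Y, hY⟩, fun _ => rfl, fun t => ?_⟩
  rw [← mkHom_flow]
  refine (AsympAlg.mk_eq_mk α).2 (α.mem_nullSeq.2 ?_)
  refine squeeze_zero_norm (a := fun n => ‖α.generator (x n)‖ * |t - 0|) (fun n => ?_)
    (by simpa using hδ.norm.mul_const |t - 0|)
  have := α.norm_apply_sub_le (hx n) 0 t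
  rw [α.map_zero'] at this
  exact this

/-- Fixed points of the flow on `A^∞_α` are represented by sequences in the domain. -/
theorem exists_domain_lift {x : α.AsympAlg} (hx : x ∈ α.asympFlow.fixedPoints)
    (hsa : IsSelfAdjoint x) :
    ∃ H : α.contSeq, IsSelfAdjoint H ∧ H ∈ α.contSeqFlow.domain ∧ α.mkHom H = x := by
  obtain ⟨X, rfl⟩ := AsympAlg.mk_surjective α x
  let Y : α.contSeq := (2⁻¹ : ℂ) • (X + star X)
  have hY : IsSelfAdjoint Y := by
    simp only [Y, IsSelfAdjoint, star_smul, star_add, star_star]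
    rw [add_comm]
    simp
  have hmY : α.mkHom Y = AsympAlg.mk X := by
    have h1 : α.mkHom Y = (2⁻¹ : ℂ) • (α.mkHom X + star (α.mkHom X)) := by
      rw [← map_star, ← map_add, ← map_smul]
    have h2 : star (α.mkHom X) = α.mkHom X := hsa
    rw [h1, h2, ← two_smul ℂ (α.mkHom X), smul_smul, inv_mul_cancel₀ two_ne_zero, one_smul]
    rfl
  -- The mean of the real part of a lift is differentiable. Its image is the mean of the orbit of
  -- `x`, which is `x` itself because `x` is fixed.
  refine ⟨α.contSeqFlow.mean Y, α.contSeqFlow.isSelfAdjoint_mean hY,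
    α.contSeqFlow.mean_mem_domain Y, ?_⟩
  rw [α.contSeqFlow.map_mean α.mkHom α.mkHom_flow, hmY]
  exact α.asympFlow.mean_of_fixed hx

end SeqHoms

end CStarFlow

/-! ### The kernel of a perturbed generator. -/

namespace CStarFlow

section Commutation

variable {U : Type*} [CStarAlgebra U] (β : CStarFlow U)

/-- `x` lies in the domain and is annihilated by the perturbed generator `δ + ad(ib)`. -/
def IsAnnihilated (b x : U) : Prop :=
  x ∈ β.domain ∧ β.generator x + Complex.I • (b * x - x * b) = 0

variable {β} {b : U}

theorem IsAnnihilated.generator_eq {x : U} (h : β.IsAnnihilated b x) :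
    β.generator x = -(Complex.I • (b * x - x * b)) := eq_neg_of_add_eq_zero_left h.2

theorem isAnnihilated_smul_one (c : ℂ) : β.IsAnnihilated b (c • 1) := by
  refine ⟨β.smul_mem_domain c β.one_mem_domain, ?_⟩
  rw [CStarFlow.generator_eq (β.hasDerivAt_smul c β.one_mem_domain), generator_one]
  simp

theorem IsAnnihilated.add {x y : U} (hx : β.IsAnnihilated b x) (hy : β.IsAnnihilated b y) :
    β.IsAnnihilated b (x + y) := by
  refine ⟨β.add_mem_domain hx.1 hy.1, ?_⟩
  rw [CStarFlow.generator_eq (β.hasDerivAt_add hx.1 hy.1), hx.generator_eq, hy.generator_eq,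
    ← neg_add, ← smul_add, mul_add, add_mul, neg_add_eq_zero]
  congr 1
  abel

/-- Both `δ` and `ad(ib)` are derivations, so the kernel of their sum is closed under products. -/
theorem IsAnnihilated.mul {x y : U} (hx : β.IsAnnihilated b x) (hy : β.IsAnnihilated b y) :
    β.IsAnnihilated b (x * y) := by
  refine ⟨β.mul_mem_domain hx.1 hy.1, ?_⟩
  rw [β.generator_mul hx.1 hy.1, hx.generator_eq, hy.generator_eq, neg_mul, mul_neg, ← neg_add,
    smul_mul_assoc, mul_smul_comm, ← smul_add, neg_add_eq_zero]
  congr 1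
  noncomm_ring

theorem IsAnnihilated.aeval {x : U} (hx : β.IsAnnihilated b x) (q : Polynomial ℝ) :
    β.IsAnnihilated b (Polynomial.aeval x q) := by
  have hr : ∀ r : ℝ, β.IsAnnihilated b (algebraMap ℝ U r) := fun r => by
    rw [Algebra.algebraMap_eq_smul_one, ← Complex.coe_smul]
    exact isAnnihilated_smul_one _
  induction q using Polynomial.induction_on with
  | C r => simpa using hr r
  | add p q hp hq => rw [map_add]; exact hp.add hq
  | monomial n r h =>
    rw [pow_succ, ← mul_assoc, map_mul, Polynomial.aeval_X]
    exact h.mul hx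

/-- On a finite spectrum every function, continuous or not, agrees with its Lagrange interpolant. -/
theorem cfc_eq_aeval_interpolate {x : U} (hx : IsSelfAdjoint x) (hfin : (spectrum ℝ x).Finite)
    (f : ℝ → ℝ) : cfc f x = Polynomial.aeval x (Lagrange.interpolate hfin.toFinset id f) := by
  rw [← cfc_polynomial _ x hx]
  refine cfc_congr fun s hs => ?_
  exact (Lagrange.eval_interpolate_at_node f (v := id) Function.injective_id.injOn
    (hfin.mem_toFinset.2 hs)).symm

theorem IsAnnihilated.cfc {x : U} (hx : β.IsAnnihilated b x) (hsa : IsSelfAdjoint x)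
    (hfin : (spectrum ℝ x).Finite) (f : ℝ → ℝ) : β.IsAnnihilated b (cfc f x) := by
  rw [cfc_eq_aeval_interpolate hsa hfin]
  exact hx.aeval _

theorem IsAnnihilated.norm_generator_le {x : U} (hx : β.IsAnnihilated b x) :
    ‖β.generator x‖ ≤ 2 * ‖b‖ * ‖x‖ := by
  rw [hx.generator_eq, norm_neg, norm_smul, Complex.norm_I, one_mul]
  have h1 := norm_sub_le (b * x) (x * b)
  have h2 := norm_mul_le b x
  have h3 := norm_mul_le x b
  nlinarith

end Commutation

/-! ### From F0 to real rank zero. -/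

variable {A : Type*} [NonUnitalCStarAlgebra A] {α : CStarFlow A}

theorem isAnnihilated_unitize_inr {b k : A} (hk : k ∈ α.domain)
    (h : α.generator k + Complex.I • (b * k - k * b) = 0) :
    α.unitize.IsAnnihilated (b : Unitization ℂ A) (k : Unitization ℂ A) := by
  refine ⟨α.mem_domain_unitize_iff.2 hk, ?_⟩
  rw [α.generator_unitize hk]
  show (α.generator k : Unitization ℂ A) + _ = 0
  rw [← Unitization.inr_mul, ← Unitization.inr_mul, ← Unitization.inr_sub,
    ← Unitization.inr_smul, ← Unitization.inr_add, h, Unitization.inr_zero]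

theorem finite_spectrum_real {U : Type*} [CStarAlgebra U] {x : U}
    (h : (spectrum ℂ x).Finite) : (spectrum ℝ x).Finite := by
  rw [← spectrum.preimage_algebraMap ℂ]
  exact h.preimage (algebraMap ℝ ℂ).injective.injOn

/-- A bounded sequence of elements annihilated by perturbations of the generator that tend to zero
represents a fixed point of the flow on `A^∞_α`. -/
theorem exists_contSeq_of_isAnnihilated {b : ℕ → A} (hb : Tendsto b atTop (𝓝 0))
    {W : ℕ → Unitization ℂ A} (hW : ∀ n, α.unitize.IsAnnihilated (b n : Unitization ℂ A) (W n))
    {w : ℂ} (hw : ∀ n, (W n).fst = w) {C : ℝ} (hC : ∀ n, ‖W n‖ ≤ C) :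
    ∃ X : α.contSeq, (∀ n, (X : BddSeq A) n = (W n).snd) ∧
      α.mkHom X ∈ α.asympFlow.fixedPoints := by
  have hd : ∀ n, (W n).snd ∈ α.domain := fun n => α.mem_domain_unitize_iff.1 (hW n).1
  refine α.exists_contSeq_of_generator_tendsto (C := C + ‖w‖) hd (fun n => ?_) ?_
  · refine (Unitization.norm_snd_le _).trans ?_
    rw [hw]
    gcongr
    exact hC n
  · refine squeeze_zero_norm (a := fun n => 2 * ‖b n‖ * C) (fun n => ?_)
      (by simpa using (hb.norm.const_mul 2).mul_const C)
    have h := (hW n).norm_generator_le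
    rw [α.generator_unitize (hd n), Unitization.norm_inr, Unitization.norm_inr] at h
    exact h.trans (mul_le_mul_of_nonneg_left (hC n) (by positivity))

theorem ConditionF0.eventually_exists (hF : α.ConditionF0) {h : ℕ → A}
    (hsa : ∀ n, IsSelfAdjoint (h n)) (hd : ∀ n, h n ∈ α.domain) {C : ℝ} (hC : ∀ n, ‖h n‖ ≤ C)
    (hδ : Tendsto (fun n => α.generator (h n)) atTop (𝓝 0)) {ε : ℝ} (hε : 0 < ε) :
    ∀ᶠ n in atTop, ∃ k b : A, IsSelfAdjoint k ∧ k ∈ α.domain ∧ IsSelfAdjoint b ∧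
        ‖h n - k‖ < ε ∧ ‖b‖ < ε ∧
        α.generator k + Complex.I • (b * k - k * b) = 0 ∧
        (quasispectrum ℂ k).Finite := by
  -- Dividing by `M ≥ C` brings `h n` into the unit ball, where F0 applies with tolerance `ε / M`.
  -- Rescaling `k` by `M` leaves `b` alone, and `M ≥ 1` keeps `‖b‖ < ε`.
  obtain ⟨M, hM1, hMC⟩ : ∃ M : ℝ, 1 ≤ M ∧ C ≤ M := ⟨max 1 C, le_max_left _ _, le_max_right _ _⟩
  have hM : 0 < M := by linarith
  have hMC' : (M : ℂ) ≠ 0 := by exact_mod_cast hM.ne'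
  have hnM : ‖(M : ℂ)‖ = M := by simp [hM.le]
  obtain ⟨ν, hν, H⟩ := hF (ε / M) (by positivity)
  filter_upwards [Metric.tendsto_nhds.1 hδ ν hν] with n hn
  rw [dist_zero_right] at hn
  have hg := generator_eq (α.hasDerivAt_smul (M : ℂ)⁻¹ (hd n))
  have hMsa : IsSelfAdjoint (M : ℂ) := Complex.conj_ofReal M
  obtain ⟨k, b, hk, hkd, hb, hhk, hbε, hkb, hfin⟩ := H ((M : ℂ)⁻¹ • h n)
    (hMsa.inv₀.smul (hsa n)) (mem_domain_of_hasDerivAt (α.hasDerivAt_smul _ (hd n)))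
    (by
      rw [norm_smul, norm_inv, hnM, inv_mul_le_iff₀ hM, mul_one]
      exact (hC n).trans hMC)
    (by
      rw [hg, norm_smul, norm_inv, hnM, inv_mul_lt_iff₀ hM]
      nlinarith)
  refine ⟨(M : ℂ) • k, b, hMsa.smul hk, mem_domain_of_hasDerivAt (α.hasDerivAt_smul _ hkd), hb,
    ?_, hbε.trans_le (div_le_self hε.le hM1), ?_, ?_⟩
  · have : h n - (M : ℂ) • k = (M : ℂ) • ((M : ℂ)⁻¹ • h n - k) := by
      rw [smul_sub, smul_inv_smul₀ hMC']
    rw [this, norm_smul, hnM]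
    rwa [lt_div_iff₀' hM] at hhk
  · rw [generator_eq (α.hasDerivAt_smul _ hkd), mul_smul_comm, smul_mul_assoc, ← smul_sub,
      smul_comm Complex.I, ← smul_add, hkb, smul_zero]
  · rw [Unitization.quasispectrum_eq_spectrum_inr] at hfin ⊢
    rw [Unitization.inr_smul]
    have := spectrum.unit_smul_eq_smul (k : Unitization ℂ A) (Units.mk0 (M : ℂ) hMC')
    have e : (M : ℂ) • (k : Unitization ℂ A) = Units.mk0 (M : ℂ) hMC' • (k : Unitization ℂ A) :=
      rfl
    rw [e, this]
    exact hfin.image _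

theorem ConditionF0.exists_seq (hF : α.ConditionF0) {h : ℕ → A}
    (hsa : ∀ n, IsSelfAdjoint (h n)) (hd : ∀ n, h n ∈ α.domain) {C : ℝ} (hC : ∀ n, ‖h n‖ ≤ C)
    (hδ : Tendsto (fun n => α.generator (h n)) atTop (𝓝 0)) :
    ∃ k b : ℕ → A, (∀ n, IsSelfAdjoint (k n) ∧ k n ∈ α.domain ∧
        α.generator (k n) + Complex.I • (b n * k n - k n * b n) = 0 ∧
        (quasispectrum ℂ (k n)).Finite) ∧
      Tendsto (fun n => h n - k n) atTop (𝓝 0) ∧ Tendsto b atTop (𝓝 0) := by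
  classical
  let P : ℕ → ℕ → Prop := fun n m => ∃ k b : A, IsSelfAdjoint k ∧ k ∈ α.domain ∧
    IsSelfAdjoint b ∧ ‖h n - k‖ < 1 / ((m : ℝ) + 1) ∧ ‖b‖ < 1 / ((m : ℝ) + 1) ∧
    α.generator k + Complex.I • (b * k - k * b) = 0 ∧ (quasispectrum ℂ k).Finite
  -- Diagonal choice: `φ n` is the best precision index up to `n` attainable at `n`. If none is
  -- attainable, `k = b = 0` serves as a default, which happens for only finitely many `n`.
  let φ : ℕ → ℕ := fun n => Nat.findGreatest (P n) n
  have hsel : ∀ n, ∃ k b : A, (IsSelfAdjoint k ∧ k ∈ α.domain ∧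
      α.generator k + Complex.I • (b * k - k * b) = 0 ∧ (quasispectrum ℂ k).Finite) ∧
      (P n (φ n) → ‖h n - k‖ < 1 / ((φ n : ℝ) + 1) ∧ ‖b‖ < 1 / ((φ n : ℝ) + 1)) := by
    intro n
    by_cases hn : P n (φ n)
    · obtain ⟨k, b, h1, h2, -, h4, h5, h6, h7⟩ := hn
      exact ⟨k, b, ⟨h1, h2, h6, h7⟩, fun _ => ⟨h4, h5⟩⟩
    · refine ⟨0, 0, ⟨.zero A, α.zero_mem_domain, by simp [α.generator_zero], ?_⟩,
        fun h => absurd h hn⟩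
      rw [Unitization.quasispectrum_eq_spectrum_inr, Unitization.inr_zero, spectrum.zero_eq]
      exact Set.finite_singleton _
  choose k b hkb hφ using hsel
  have key : ∀ ε : ℝ, 0 < ε → ∀ᶠ n in atTop, ‖h n - k n‖ < ε ∧ ‖b n‖ < ε := by
    intro ε hε
    obtain ⟨m, hm⟩ := exists_nat_one_div_lt hε
    filter_upwards [eventually_ge_atTop m, hF.eventually_exists hsa hd hC hδ
      (Nat.one_div_pos_of_nat (α := ℝ) (n := m))] with n hn hP
    have h1 : P n (φ n) := Nat.findGreatest_spec hn hP
    have h2 : m ≤ φ n := Nat.le_findGreatest hn hP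
    have h3 : 1 / ((φ n : ℝ) + 1) ≤ 1 / ((m : ℝ) + 1) := Nat.one_div_le_one_div h2
    obtain ⟨h4, h5⟩ := hφ n h1
    exact ⟨by linarith, by linarith⟩
  refine ⟨k, b, hkb, Metric.tendsto_nhds.2 fun ε hε => ?_, Metric.tendsto_nhds.2 fun ε hε => ?_⟩
  · filter_upwards [key ε hε] with n hn
    simpa using hn.1
  · filter_upwards [key ε hε] with n hn
    simpa using hn.2

/-- Pushing the reals away from the interval `(-ρ, ρ)`. -/
noncomputable def pushOut (ρ s : ℝ) : ℝ := if |s| < ρ then ρ else s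

theorem le_abs_pushOut {ρ : ℝ} (hρ : 0 < ρ) (s : ℝ) : ρ ≤ |pushOut ρ s| := by
  rw [pushOut]
  split_ifs with h
  · rw [abs_of_pos hρ]
  · exact not_lt.1 h

theorem abs_pushOut_sub_le {ρ : ℝ} (hρ : 0 < ρ) (s : ℝ) : |pushOut ρ s - s| ≤ 2 * ρ := by
  rw [pushOut]
  split_ifs with h
  · rw [abs_lt] at h
    rw [abs_le]
    constructor <;> linarith
  · simp [hρ.le]

theorem pushOut_of_le {ρ s : ℝ} (h : ρ ≤ |s|) : pushOut ρ s = s := if_neg h.not_gt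

theorem hasRealRankZero_of_conditionF0 (hF : α.ConditionF0) :
    HasRealRankZero α.asympFlow.fixedPoints := by
  refine Metric.dense_iff.2 fun z ε hε => ?_
  obtain ⟨hz1, hz2⟩ := Unitization.isSelfAdjoint_iff_fst_snd.1 z.2
  obtain ⟨r, hr⟩ := Complex.conj_eq_iff_real.1 hz1
  obtain ⟨H, hHsa, hHd, hHx⟩ := α.exists_domain_lift (x := (z : Unitization ℂ α.asympFlow.fixedPoints).snd)
    (z : Unitization ℂ α.asympFlow.fixedPoints).snd.2 (congrArg Subtype.val hz2)
  -- An invertible element of the unitization needs a nonzero scalar part.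
  obtain ⟨l, hl0, hlr⟩ : ∃ l : ℝ, l ≠ 0 ∧ |r - l| < ε / 4 := by
    by_cases h : r = 0
    · exact ⟨ε / 8, by positivity, by rw [h, zero_sub, abs_neg, abs_of_pos] <;> linarith⟩
    · exact ⟨r, h, by simpa using hε⟩
  -- `ρ ≤ |l|` makes `pushOut ρ` fix `l`, so the scalar parts of the modified elements and of their
  -- inverses are `l` and `l⁻¹` for every `n`. `ρ ≤ ε / 8` keeps the total error `|r - l| + 3ρ`
  -- below `ε`.
  obtain ⟨ρ, hρ, hρl, hρε⟩ : ∃ ρ : ℝ, 0 < ρ ∧ ρ ≤ |l| ∧ ρ ≤ ε / 8 :=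
    ⟨min |l| (ε / 8), lt_min (abs_pos.2 hl0) (by positivity), min_le_left _ _, min_le_right _ _⟩
  have hev := fun n => α.contSeqFlow.hasDerivAt_map (α.evalHom n) (α.evalHom_flow n) hHd
  have hδ0 : α.mkHom (α.contSeqFlow.generator H) = 0 := by
    rw [← generator_eq (α.contSeqFlow.hasDerivAt_map α.mkHom α.mkHom_flow hHd), hHx]
    exact α.asympFlow.generator_eq_zero_of_fixed (z : Unitization ℂ α.asympFlow.fixedPoints).snd.2
  obtain ⟨k, b, hk, hhk, hb⟩ := hF.exists_seq (h := fun n => α.evalHom n H)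
    (fun n => hHsa.map (α.evalHom n)) (fun n => mem_domain_of_hasDerivAt (hev n)) (C := ‖H‖)
    (fun n => NonUnitalStarAlgHom.norm_apply_le _ _) (by
      simp only [fun n => generator_eq (hev n)]
      exact α.tendsto_of_mkHom_eq_zero hδ0)
  let K : ℕ → Unitization ℂ A := fun n => (l : ℂ) • 1 + (k n : Unitization ℂ A)
  have hKsa : ∀ n, IsSelfAdjoint (K n) := fun n => Unitization.isSelfAdjoint_iff_fst_snd.2
    ⟨by simp [K, IsSelfAdjoint], by simpa [K] using (hk n).1⟩
  have hKfst : ∀ n, (K n).fst = (l : ℂ) := fun n => by simp [K]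
  have hKsnd : ∀ n, (K n).snd = k n := fun n => by simp [K]
  have hKfin : ∀ n, (spectrum ℝ (K n)).Finite := fun n => by
    refine finite_spectrum_real ?_
    have := (hk n).2.2.2
    rw [Unitization.quasispectrum_eq_spectrum_inr] at this
    rw [show K n = algebraMap ℂ (Unitization ℂ A) l + (k n : Unitization ℂ A) by
      rw [Algebra.algebraMap_eq_smul_one], ← spectrum.singleton_add_eq]
    exact (Set.finite_singleton _).add this
  have hKann : ∀ n, α.unitize.IsAnnihilated (b n : Unitization ℂ A) (K n) := fun n =>
    (isAnnihilated_smul_one _).add (isAnnihilated_unitize_inr (hk n).2.1 (hk n).2.2.1)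
  have hcont : ∀ n (f : ℝ → ℝ), ContinuousOn f (spectrum ℝ (K n)) := fun n f =>
    (hKfin n).continuousOn f
  have hpl : pushOut ρ l = l := pushOut_of_le hρl
  have hYK : ∀ n, ‖cfc (pushOut ρ) (K n) - K n‖ ≤ 2 * ρ := fun n => by
    have : cfc (pushOut ρ) (K n) - K n = cfc (fun s => pushOut ρ s - s) (K n) := by
      rw [cfc_sub _ _ (K n) (hcont n _) (hcont n _), cfc_id' ℝ (K n)]
    rw [this]
    exact norm_cfc_le (by positivity) fun s _ => abs_pushOut_sub_le hρ s
  obtain ⟨D, hD⟩ : ∃ D : ℝ, ∀ n, ‖K n‖ ≤ D := by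
    obtain ⟨D, hD⟩ := hhk.norm.bddAbove_range
    refine ⟨|l| + (‖H‖ + D), fun n => (Unitization.norm_le_norm_fst_add _).trans ?_⟩
    rw [hKfst, hKsnd, Complex.norm_real, Real.norm_eq_abs]
    gcongr
    have h1 : ‖α.evalHom n H - k n‖ ≤ D := hD ⟨n, rfl⟩
    have h2 : ‖α.evalHom n H‖ ≤ ‖H‖ := NonUnitalStarAlgHom.norm_apply_le _ _
    have h3 := norm_sub_norm_le (k n) (α.evalHom n H)
    rw [norm_sub_rev] at h3
    linarith
  obtain ⟨Y, hY, hYfix⟩ := exists_contSeq_of_isAnnihilated hb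
    (fun n => (hKann n).cfc (hKsa n) (hKfin n) (pushOut ρ)) (w := l)
    (fun n => by rw [Unitization.fst_cfc (hKsa n) (hKfst n) (hcont n _), hpl])
    (C := D + 2 * ρ) (fun n => by
      have h1 := norm_sub_norm_le (cfc (pushOut ρ) (K n)) (K n)
      linarith [hYK n, hD n])
  obtain ⟨Z, hZ, hZfix⟩ := exists_contSeq_of_isAnnihilated hb
    (fun n => (hKann n).cfc (hKsa n) (hKfin n) fun s => (pushOut ρ s)⁻¹) (w := (l⁻¹ : ℝ))
    (fun n => by rw [Unitization.fst_cfc (hKsa n) (hKfst n) (hcont n _), hpl])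
    (C := ρ⁻¹) (fun n => norm_cfc_le (by positivity) fun s _ => by
      rw [norm_inv, Real.norm_eq_abs]
      exact inv_anti₀ hρ (le_abs_pushOut hρ s))
  have hne : ∀ s, pushOut ρ s ≠ 0 := fun s h => by
    have := le_abs_pushOut hρ s
    rw [h, abs_zero] at this
    linarith
  -- This is the non-scalar part of `(l + Y)(l⁻¹ + Z) = 1`, read off entrywise.
  have hYZ : (l : ℂ) • Z + ((l⁻¹ : ℝ) : ℂ) • Y + Y * Z = 0 := by
    refine Subtype.ext ?_
    ext n
    have h1 : cfc (pushOut ρ) (K n) * cfc (fun s => (pushOut ρ s)⁻¹) (K n) = 1 := by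
      rw [← cfc_mul _ _ (K n) (hcont n _) (hcont n _), ← cfc_const_one ℝ (K n)]
      exact cfc_congr fun s _ => mul_inv_cancel₀ (hne s)
    have h2 := congrArg (fun u : Unitization ℂ A => u.snd) h1
    beta_reduce at h2
    rw [Unitization.snd_mul, Unitization.fst_cfc (hKsa n) (hKfst n) (hcont n _),
      Unitization.fst_cfc (hKsa n) (hKfst n) (hcont n _), hpl, ← hY, ← hZ] at h2
    exact h2
  have hZY : ((l⁻¹ : ℝ) : ℂ) • Y + (l : ℂ) • Z + Z * Y = 0 := by
    refine Subtype.ext ?_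
    ext n
    have h1 : cfc (fun s => (pushOut ρ s)⁻¹) (K n) * cfc (pushOut ρ) (K n) = 1 := by
      rw [← cfc_mul _ _ (K n) (hcont n _) (hcont n _), ← cfc_const_one ℝ (K n)]
      exact cfc_congr fun s _ => inv_mul_cancel₀ (hne s)
    have h2 := congrArg (fun u : Unitization ℂ A => u.snd) h1
    beta_reduce at h2
    rw [Unitization.snd_mul, Unitization.fst_cfc (hKsa n) (hKfst n) (hcont n _),
      Unitization.fst_cfc (hKsa n) (hKfst n) (hcont n _), hpl, ← hY, ← hZ] at h2
    exact h2
  have hYsa : IsSelfAdjoint Y := by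
    refine Subtype.ext ?_
    ext n
    have h1 : IsSelfAdjoint (cfc (pushOut ρ) (K n)) := cfc_predicate (p := IsSelfAdjoint) _ _
    have h2 := (Unitization.isSelfAdjoint_iff_fst_snd.1 h1).2
    rw [← hY] at h2
    exact h2
  let y : α.asympFlow.fixedPoints := ⟨α.mkHom Y, hYfix⟩
  let z' : α.asympFlow.fixedPoints := ⟨α.mkHom Z, hZfix⟩
  let W : Unitization ℂ α.asympFlow.fixedPoints := ⟨((l : ℂ), y)⟩
  let V : Unitization ℂ α.asympFlow.fixedPoints := ⟨(((l⁻¹ : ℝ) : ℂ), z')⟩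
  have hll : (l : ℂ) * ((l⁻¹ : ℝ) : ℂ) = 1 := by
    rw [← Complex.ofReal_mul, mul_inv_cancel₀ hl0, Complex.ofReal_one]
  have hWV : W * V = 1 := by
    refine Unitization.ext hll (Subtype.ext ?_)
    have := congrArg α.mkHom hYZ
    rw [map_add, map_add, map_smul, map_smul, map_mul, map_zero] at this
    exact this
  have hVW : V * W = 1 := by
    refine Unitization.ext ((mul_comm _ _).trans hll) (Subtype.ext ?_)
    have := congrArg α.mkHom hZY
    rw [map_add, map_add, map_smul, map_smul, map_mul, map_zero] at this
    exact this
  have hWsa : IsSelfAdjoint W := Unitization.isSelfAdjoint_iff_fst_snd.2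
    ⟨Complex.conj_ofReal l, Subtype.ext (hYsa.map α.mkHom)⟩
  refine ⟨⟨W, hWsa⟩, ?_, ⟨⟨W, V, hWV, hVW⟩, rfl⟩⟩
  -- Eventually `ρ` bounds the distance from the lift to `k n`, and `2ρ` is the cost of pushing the
  -- spectrum out.
  have h1 : ‖((z : Unitization ℂ α.asympFlow.fixedPoints).snd : α.AsympAlg) - α.mkHom Y‖
      ≤ 3 * ρ := by
    rw [← hHx]
    refine α.norm_mkHom_sub_le (by positivity) ?_
    filter_upwards [Metric.tendsto_nhds.1 hhk ρ hρ] with n hn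
    rw [dist_zero_right] at hn
    have h2 := Unitization.norm_snd_le (K n - cfc (pushOut ρ) (K n))
    have h3 : (K n - cfc (pushOut ρ) (K n)).snd = k n - (Y : BddSeq A) n := by
      rw [hY, ← hKsnd n]; rfl
    have h4 : (K n - cfc (pushOut ρ) (K n)).fst = 0 := by
      have : (K n).fst - (cfc (pushOut ρ) (K n)).fst = 0 := by
        rw [Unitization.fst_cfc (hKsa n) (hKfst n) (hcont n _), hpl, hKfst, sub_self]
      exact this
    rw [h3, h4, norm_zero, add_zero, norm_sub_rev (K n)] at h2
    have h5 := norm_sub_le_norm_sub_add_norm_sub (α.evalHom n H) (k n) ((Y : BddSeq A) n)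
    have h6 := hYK n
    have h7 : ‖α.evalHom n H - (Y : BddSeq A) n‖ ≤ 3 * ρ := by linarith
    exact h7
  have h8 := Unitization.norm_le_norm_fst_add ((z : Unitization ℂ α.asympFlow.fixedPoints) - W)
  have h9 : ‖((z : Unitization ℂ α.asympFlow.fixedPoints) - W).fst‖ = |r - l| := by
    have : ((z : Unitization ℂ α.asympFlow.fixedPoints) - W).fst = ((r - l : ℝ) : ℂ) := by
      rw [Complex.ofReal_sub, ← hr]; rfl
    rw [this, Complex.norm_real, Real.norm_eq_abs]
  have h10 : ‖((z : Unitization ℂ α.asympFlow.fixedPoints) - W).snd‖ ≤ 3 * ρ := h1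
  rw [Metric.mem_ball', Subtype.dist_eq, dist_eq_norm]
  show ‖(z : Unitization ℂ α.asympFlow.fixedPoints) - W‖ < ε
  linarith

end CStarFlow

/-! ### From real rank zero to F0. -/

namespace CStarFlow

theorem ofReal_mem_spectrum {U : Type*} [CStarAlgebra U] {x : U} {r : ℝ}
    (h : r ∈ spectrum ℝ x) : (r : ℂ) ∈ spectrum ℂ x := by
  rwa [← spectrum.preimage_algebraMap ℂ] at h

/-- If the invertible self-adjoint elements are dense, then every self-adjoint element is close to
one whose spectrum avoids a given countable set of reals. -/
theorem dense_isUnit_sub_of_dense_isUnit {C ι : Type*} [CStarAlgebra C] [Countable ι]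
    (h : Dense {x : selfAdjoint C | IsUnit (x : C)}) (μ : ι → ℝ) :
    Dense {x : selfAdjoint C | ∀ i, IsUnit ((x : C) - algebraMap ℂ C (μ i : ℂ))} := by
  have hcl : IsClosed ((selfAdjoint C : AddSubgroup C) : Set C) :=
    isClosed_eq continuous_star continuous_id
  have : CompleteSpace (selfAdjoint C) := hcl.completeSpace_coe
  let m : ι → selfAdjoint C := fun i =>
    ⟨algebraMap ℂ C (μ i : ℂ), (show IsSelfAdjoint (μ i : ℂ) from Complex.conj_ofReal _).algebraMap C⟩
  have hop : IsOpen {x : selfAdjoint C | IsUnit (x : C)} :=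
    Units.isOpen.preimage continuous_subtype_val
  have : {x : selfAdjoint C | ∀ i, IsUnit ((x : C) - algebraMap ℂ C (μ i : ℂ))}
      = ⋂ i, (fun x => x - m i) ⁻¹' {x : selfAdjoint C | IsUnit (x : C)} := by
    ext x
    simp [m]
  rw [this]
  -- Baire: each condition is a translate of the dense open set of invertibles in the complete space
  -- of self-adjoint elements.
  exact dense_iInter_of_isOpen (fun i => hop.preimage (by fun_prop))
    fun i => h.preimage (Homeomorph.subRight (m i)).isOpenMap

variable {A : Type*} [NonUnitalCStarAlgebra A] (α : CStarFlow A)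

/-- Lift an inverse modulo `c_0` to `W`. Then `H W` and `W H` are `1` plus null sequences, whose
tails have norm below `1`, so far truncations of both products are invertible. -/
theorem eventually_isUnit_trunc {H : Unitization ℂ α.contSeq}
    (hH : IsUnit (Unitization.starMap α.mkHom H)) :
    ∀ᶠ N in atTop, IsUnit (Unitization.starMap (α.trunc N) H) := by
  obtain ⟨w, hw1, hw2⟩ : ∃ w, Unitization.starMap α.mkHom H * w = 1 ∧
      w * Unitization.starMap α.mkHom H = 1 := by
    obtain ⟨u, hu⟩ := hH
    exact ⟨_, hu ▸ u.mul_inv, hu ▸ u.inv_mul⟩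
  obtain ⟨W, rfl⟩ := Unitization.starMap_surjective (φ := α.mkHom)
    (AsympAlg.mk_surjective α) w
  have key : ∀ D : Unitization ℂ α.contSeq, Unitization.starMap α.mkHom D = 1 →
      ∀ᶠ N in atTop, IsUnit (Unitization.starMap (α.trunc N) D) := by
    intro D hD
    have h1 : D.fst = 1 := by
      rw [← Unitization.fst_starMap α.mkHom, hD, Unitization.fst_one]
    have h2 : α.mkHom D.snd = 0 := by
      rw [← Unitization.snd_starMap α.mkHom, hD, Unitization.snd_one]
    filter_upwards [α.eventually_norm_trunc_lt h2 one_pos] with N hN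
    have h3 : Unitization.starMap (α.trunc N) D
        = 1 - ((-α.trunc N D.snd : α.contSeq) : Unitization ℂ α.contSeq) := by
      refine Unitization.ext ?_ ?_
      · rw [Unitization.fst_starMap, h1, sub_eq_add_neg]
        simp
      · rw [Unitization.snd_starMap, sub_eq_add_neg]
        simp
    rw [h3]
    refine isUnit_one_sub_of_norm_lt_one ?_
    rwa [Unitization.norm_inr, norm_neg]
  filter_upwards [key (H * W) (by rw [map_mul, hw1]), key (W * H) (by rw [map_mul, hw2])]
    with N h1 h2
  rw [map_mul] at h1 h2
  obtain ⟨u, hu⟩ := h1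
  obtain ⟨v, hv⟩ := h2
  exact isUnit_iff_exists_and_exists.2
    ⟨⟨_, by rw [← mul_assoc, ← hu]; exact u.mul_inv⟩, ⟨_, by rw [mul_assoc, ← hv]; exact v.inv_mul⟩⟩

/-- A self-adjoint element over the fixed point algebra of `A^∞_α` whose spectrum avoids the
midpoints between consecutive multiples of `η` lifts to an element over `ℓ^∞_α` in the domain with
the same property. -/
theorem exists_lift_avoiding {η : ℝ} (hη : 0 < η)
    {h : Unitization ℂ α.asympFlow.fixedPoints} (hsa : IsSelfAdjoint h)
    (hμ : ∀ j : ℤ, IsUnit (h - algebraMap ℂ _ ((η * ((j : ℝ) + 1 / 2) : ℝ) : ℂ))) :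
    ∃ H : Unitization ℂ α.contSeq, IsSelfAdjoint H ∧ H ∈ α.contSeqFlow.unitize.domain ∧
      Unitization.starMap α.mkHom H
        = Unitization.starMap (NonUnitalStarSubalgebraClass.subtype α.asympFlow.fixedPoints) h ∧
      ∀ j : ℤ, η * ((j : ℝ) + 1 / 2) ∉ spectrum ℝ H := by
  obtain ⟨h1, h2⟩ := Unitization.isSelfAdjoint_iff_fst_snd.1 hsa
  obtain ⟨X, hXsa, hXd, hX⟩ := α.exists_domain_lift (x := h.snd) h.snd.2 (congrArg Subtype.val h2)
  let H₀ : Unitization ℂ α.contSeq := ⟨(h.fst, X)⟩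
  let ι := NonUnitalStarSubalgebraClass.subtype α.asympFlow.fixedPoints
  have hH₀ : Unitization.starMap α.mkHom H₀ = Unitization.starMap ι h := by
    refine Unitization.ext ?_ ?_
    · rw [Unitization.fst_starMap, Unitization.fst_starMap]
    · rw [Unitization.snd_starMap, Unitization.snd_starMap]
      exact hX
  have hev : ∀ j : ℤ, ∀ᶠ N in atTop, IsUnit (Unitization.starMap (α.trunc N) H₀
      - algebraMap ℂ _ ((η * ((j : ℝ) + 1 / 2) : ℝ) : ℂ)) := by
    intro j
    have := α.eventually_isUnit_trunc (H := H₀ - algebraMap ℂ _ ((η * ((j : ℝ) + 1 / 2) : ℝ) : ℂ)) (by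
      rw [map_sub, hH₀, AlgHomClass.commutes, ← AlgHomClass.commutes (Unitization.starMap ι),
        ← map_sub]
      exact (hμ j).map (Unitization.starMap ι))
    simpa only [map_sub, AlgHomClass.commutes] using this
  -- Truncation does not increase the norm, so only midpoints with `|j + 1/2| < M` could meet the
  -- spectrum; one truncation handles these finitely many.
  obtain ⟨M, hM⟩ := exists_nat_gt (‖H₀‖ / η)
  obtain ⟨N, hN⟩ := ((Finset.Icc (-M - 1 : ℤ) M).eventually_all.2 fun j _ => hev j).exists
  have hsa₀ : IsSelfAdjoint H₀ := Unitization.isSelfAdjoint_iff_fst_snd.2 ⟨h1, hXsa⟩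
  refine ⟨Unitization.starMap (α.trunc N) H₀, hsa₀.map _, ?_, ?_, fun j hj => ?_⟩
  · rw [mem_domain_unitize_iff, Unitization.snd_starMap]
    exact mem_domain_of_hasDerivAt
      (α.contSeqFlow.hasDerivAt_map (α.trunc N) (α.trunc_flow N) hXd)
  · rw [← hH₀]
    refine Unitization.ext ?_ ?_
    · simp only [Unitization.fst_starMap]
    · simp only [Unitization.snd_starMap, mkHom_trunc]
  · have hj' : ((η * ((j : ℝ) + 1 / 2) : ℝ) : ℂ)
        ∈ spectrum ℂ (Unitization.starMap (α.trunc N) H₀) := ofReal_mem_spectrum hj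
    by_cases hjM : j ∈ Finset.Icc (-M - 1 : ℤ) M
    · refine hj' ?_
      have := (hN j hjM).neg
      rwa [neg_sub] at this
    · have h3 := spectrum.norm_le_norm_of_mem hj'
      have h4 : ‖Unitization.starMap (α.trunc N) H₀‖ ≤ ‖H₀‖ :=
        NonUnitalStarAlgHom.norm_apply_le _ _
      have h5 : ‖H₀‖ < η * M := by rwa [div_lt_iff₀' hη] at hM
      rw [Complex.norm_real, norm_mul, Real.norm_of_nonneg hη.le] at h3
      have h6 : ‖(j : ℝ) + 1 / 2‖ < M :=
        lt_of_mul_lt_mul_left ((h3.trans h4).trans_lt h5) hη.le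
      rw [Real.norm_eq_abs, abs_lt] at h6
      refine hjM (Finset.mem_Icc.2 ⟨?_, ?_⟩)
      · have : ((-M - 1 : ℤ) : ℝ) ≤ j := by push_cast; linarith
        exact_mod_cast this
      · have : (j : ℝ) ≤ ((M : ℤ) : ℝ) := by push_cast; linarith
        exact_mod_cast this

/-- Self-adjoint fixed points of the flow on `A^∞_α` are approximated by sequences of elements with
finite spectrum that are annihilated by perturbations of the generator tending to zero. -/
theorem exists_finite_spectrum_seq (hB : HasRealRankZero α.asympFlow.fixedPoints)
    {X : α.contSeq} (hX : α.mkHom X ∈ α.asympFlow.fixedPoints)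
    (hsa : IsSelfAdjoint (α.mkHom X)) {ε : ℝ} (hε : 0 < ε) :
    ∃ k b : α.contSeq, IsSelfAdjoint k ∧ k ∈ α.contSeqFlow.domain ∧ IsSelfAdjoint b ∧
      ‖α.mkHom X - α.mkHom k‖ < ε ∧ α.mkHom b = 0 ∧
      α.contSeqFlow.generator k + Complex.I • (b * k - k * b) = 0 ∧
      (quasispectrum ℂ k).Finite := by
  let x : α.asympFlow.fixedPoints := ⟨α.mkHom X, hX⟩
  have hxsa : IsSelfAdjoint (x : Unitization ℂ α.asympFlow.fixedPoints) :=
    Unitization.isSelfAdjoint_iff_fst_snd.2 ⟨star_zero _, Subtype.ext hsa⟩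
  -- Approximating `x` by `h` and rounding off the lift each cost at most `η / 2`.
  obtain ⟨η, hη, hηε⟩ : ∃ η : ℝ, 0 < η ∧ η < ε := ⟨ε / 2, half_pos hε, half_lt_self hε⟩
  obtain ⟨⟨h, hhsa⟩, hhx, hhμ⟩ := Metric.dense_iff.1 (dense_isUnit_sub_of_dense_isUnit hB
    fun j : ℤ => η * ((j : ℝ) + 1 / 2)) ⟨x, hxsa⟩ (η / 2) (half_pos hη)
  rw [Metric.mem_ball', Subtype.dist_eq, dist_eq_norm] at hhx
  change ‖(x : Unitization ℂ α.asympFlow.fixedPoints) - h‖ < η / 2 at hhx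
  obtain ⟨H, hHsa, hHd, hHh, hμ⟩ := α.exists_lift_avoiding hη hhsa hhμ
  let ι := NonUnitalStarSubalgebraClass.subtype α.asympFlow.fixedPoints
  let π := Unitization.starMap α.mkHom
  have hfix : ∀ t, α.asympFlow.unitize t (π H) = π H := fun t => by
    refine Unitization.ext (fst_unitize ..) ?_
    rw [snd_unitize, hHh, Unitization.snd_starMap]
    exact h.snd.2 t
  obtain ⟨N, hN⟩ := exists_round_mem_Icc η H
  let k' := roundOff η H
  let b' := α.contSeqFlow.unitize.stepPerturb η H N
  obtain ⟨r, hr⟩ := Complex.conj_eq_iff_real.1 (Unitization.isSelfAdjoint_iff_fst_snd.1 hHsa).1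
  -- `x` has scalar part `0`, so that of `h` is small enough to round to `0`. This brings the
  -- rounded element back from the unitization into `ℓ^∞_α`.
  have hrη : |r| < η / 2 := by
    have h1 : H.fst = h.fst := by
      rw [← Unitization.fst_starMap α.mkHom, hHh, Unitization.fst_starMap]
    have h2 : ‖((x : Unitization ℂ α.asympFlow.fixedPoints) - h).fst‖ = |r| := by
      have : ((x : Unitization ℂ α.asympFlow.fixedPoints) - h).fst = 0 - h.fst := rfl
      rw [this, zero_sub, norm_neg, ← h1, hr, Complex.norm_real, Real.norm_eq_abs]
    rw [← h2]
    exact (NonUnitalStarAlgHom.norm_apply_le (Unitization.fstStarHom α.asympFlow.fixedPoints) _).trans_lt hhx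
  have hk0 : k'.fst = 0 := by
    have h1 : k'.fst = _ := Unitization.fst_cfc hHsa hr
      (continuousOn_step hη hμ fun j => η * (j : ℝ))
    have h2 : round (r / η) = 0 := by
      rw [round_div_eq_iff hη]
      rw [abs_lt] at hrη
      push_cast
      constructor <;> linarith
    rw [h1, h2]
    simp
  -- The generator on the unitization takes values in the non-unital part, which is an ideal.
  have hb0 : b'.fst = 0 := by
    have h1 : b' = Complex.I • ∑ j ∈ Finset.Icc (-N : ℤ) N,
      α.contSeqFlow.unitize.generator (stepProj η H j) * stepProj η H j := rfl
    have h2 : Unitization.fstStarHom α.contSeq b' = 0 := by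
      rw [h1, map_smul, map_sum, Finset.sum_eq_zero, smul_zero]
      intro j _
      rw [generator_unitize _ (α.contSeqFlow.mem_domain_unitize_iff.1
        (α.contSeqFlow.unitize.stepProj_mem_domain hη hHsa hHd hμ j)), map_mul]
      exact zero_mul _
    exact h2
  have hkk : ((k'.snd : α.contSeq) : Unitization ℂ α.contSeq) = k' :=
    Unitization.ext hk0.symm rfl
  have hbb : ((b'.snd : α.contSeq) : Unitization ℂ α.contSeq) = b' :=
    Unitization.ext hb0.symm rfl
  have hkd : k'.snd ∈ α.contSeqFlow.domain := α.contSeqFlow.mem_domain_unitize_iff.1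
    (α.contSeqFlow.unitize.roundOff_mem_domain hη hHsa hHd hμ)
  refine ⟨k'.snd, b'.snd,
    (Unitization.isSelfAdjoint_iff_fst_snd.1 isSelfAdjoint_roundOff).2, hkd,
    (Unitization.isSelfAdjoint_iff_fst_snd.1
      (α.contSeqFlow.unitize.isSelfAdjoint_stepPerturb hη hHsa hHd hμ hN)).2, ?_, ?_, ?_, ?_⟩
  · have h1 : ‖π H - π k'‖ ≤ η / 2 := by
      rw [← map_sub]
      exact (NonUnitalStarAlgHom.norm_apply_le π _).trans (norm_sub_roundOff_le hη hHsa hμ)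
    have h2 : ‖Unitization.starMap ι x - π H‖ < η / 2 := by
      rw [hHh, ← map_sub]
      exact (NonUnitalStarAlgHom.norm_apply_le (Unitization.starMap ι) _).trans_lt hhx
    have h3 : Unitization.starMap ι x - π k'
        = ((α.mkHom X - α.mkHom k'.snd : α.AsympAlg) : Unitization ℂ α.AsympAlg) := by
      have e1 : Unitization.starMap ι x = ((α.mkHom X : α.AsympAlg) : Unitization ℂ α.AsympAlg) :=
        Unitization.starMap_inr ι x
      have e2 : π k' = ((α.mkHom k'.snd : α.AsympAlg) : Unitization ℂ α.AsympAlg) := by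
        rw [← hkk]
        exact Unitization.starMap_inr α.mkHom _
      rw [e1, e2, Unitization.inr_sub]
    have h4 := norm_sub_le_norm_sub_add_norm_sub (Unitization.starMap ι x) (π H) (π k')
    rw [h3, Unitization.norm_inr] at h4
    linarith
  · have := α.contSeqFlow.unitize.map_stepPerturb_eq_zero hη hHsa hHd hμ π
      (fun t z => starMap_unitize _ α.mkHom_flow t z) hfix N
    rw [← Unitization.snd_starMap]
    exact (congrArg (fun u : Unitization ℂ α.AsympAlg => u.snd) this)
  · have h1 := α.contSeqFlow.unitize.generator_roundOff_add hη hHsa hHd hμ hN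
    rw [generator_unitize _ hkd] at h1
    change (α.contSeqFlow.generator k'.snd : Unitization ℂ α.contSeq)
      + Complex.I • (b' * k' - k' * b') = 0 at h1
    rw [← hkk, ← hbb, ← Unitization.inr_mul, ← Unitization.inr_mul, ← Unitization.inr_sub,
      ← Unitization.inr_smul, ← Unitization.inr_add, Unitization.snd_inr] at h1
    exact Unitization.inr_injective h1
  · rw [Unitization.quasispectrum_eq_spectrum_inr, hkk]
    exact finite_spectrum_roundOff hη hHsa hμ

theorem conditionF0_of_hasRealRankZero (hB : HasRealRankZero α.asympFlow.fixedPoints) :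
    α.ConditionF0 := by
  intro ε hε
  by_contra! hcon
  -- Failure of F0 at `ε` is applied with `ν = 1 / (n + 1)`, so the counterexamples satisfy `δ(h_n)
  -- → 0`.
  choose h hsa hd hn hδ hbad using fun n : ℕ =>
    hcon (1 / ((n : ℝ) + 1)) Nat.one_div_pos_of_nat
  have hδ0 : Tendsto (fun n => α.generator (h n)) atTop (𝓝 0) :=
    squeeze_zero_norm (fun n => (hδ n).le) tendsto_one_div_add_atTop_nhds_zero_nat
  obtain ⟨X, hX, hXfix⟩ := α.exists_contSeq_of_generator_tendsto hd hn hδ0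
  have hXsa : IsSelfAdjoint X := by
    refine Subtype.ext ?_
    ext n
    have := hsa n
    rw [← hX] at this
    exact this
  obtain ⟨k, b, hk, hkd, hb, hXk, hb0, hkb, hfin⟩ :=
    α.exists_finite_spectrum_seq hB hXfix (hXsa.map α.mkHom) hε
  rw [← map_sub] at hXk
  -- The quotient norm controls late entries. Evaluation at such an `n` is equivariant and does not
  -- enlarge spectra, so the entries of `k` and `b` contradict `hbad n`.
  obtain ⟨n, hn1, hn2⟩ := ((AsympAlg.eventually_norm_lt α hXk).and
    (Metric.tendsto_nhds.1 (α.tendsto_of_mkHom_eq_zero hb0) ε hε)).exists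
  rw [dist_zero_right] at hn2
  have hev := α.contSeqFlow.hasDerivAt_map (α.evalHom n) (α.evalHom_flow n) hkd
  refine hbad n (α.evalHom n k) (α.evalHom n b) (hk.map _) (mem_domain_of_hasDerivAt hev)
    (hb.map _) ?_ hn2 ?_ ?_
  · rw [← hX]
    exact hn1
  · rw [generator_eq hev, ← map_mul, ← map_mul, ← map_sub, ← map_smul, ← map_add, hkb, map_zero]
  · rw [Unitization.quasispectrum_eq_spectrum_inr] at hfin ⊢
    rw [← Unitization.starMap_inr]
    exact hfin.subset (AlgHom.spectrum_apply_subset _ _)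

end CStarFlow

theorem proposition3p8 {A : Type*} [NonUnitalCStarAlgebra A] (α : CStarFlow A) :
    α.ConditionF0 ↔ HasRealRankZero α.asympFlow.fixedPoints :=
  ⟨CStarFlow.hasRealRankZero_of_conditionF0, α.conditionF0_of_hasRealRankZero⟩
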